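/- All graphs are finite and simple; multigraphs are finite, may have parallel edges, and have no loops. $\chi(G)$ and $\omega(G)$ denote the chromatic number and the clique number of $G$, and $\chi^{\rho}(G)$ denotes the maximum, over all vertices $v$ of $G$, of the chromatic number of the subgraph induced on the set of vertices at distance at most $\rho$ from $v$ (zero for the null graph). A graph $J$ is a *subdivision* of a multigraph $H$ if it is obtained from $H$ by replacing each edge $uv$ by a path of length at least one joining $u,v$, these paths being vertex-disjoint except for their ends. A graph $G$ is *$H$-subdivision-free* if no induced subgraph of $G$ is (isomorphic to) a subdivision of $H$. An *ideal* is a class of graphs closed under taking induced subgraphs (and isomorphism); it is *$\rho$-bounded* if there is $\tau$ with $\chi^{\rho}(G)\le\tau$ for all its members $G$, and *colourable* if there is $k$ with $\chi(G)\le k$ for all its members $G$. A multigraph $H$ is *widespread* if for every subdivision $J$ of $H$ and all $\kappa\ge 0$ there exists $\rho\ge 0$ such that every $\rho$-bounded ideal of $J$-subdivision-free graphs $G$ with $\omega(G)\le\kappa$ is colourable. *Fattening* an edge $uv$ of a multigraph means replacing it by a nonempty set of parallel edges joining $u,v$. A *banana* with ends $s,t$ is the union of a nonempty set of paths of positive length,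 all with ends $s,t$ and otherwise disjoint; *substituting a banana* for an edge $uv$ means replacing the edge by a banana with ends $u,v$ that is otherwise disjoint from the rest. Cycles have length at least two, a cycle of length two being a pair of parallel edges. **Theorem.** (a) Let $H$ be a multigraph obtained from a cycle by fattening all except one of its edges. Then $H$ is widespread. (b) Let $J$ be a (simple) graph obtained from a cycle of length $m\ge 2$ by substituting bananas for all except one of its edges. Then for all integers $\kappa,\tau\ge 0$ there exists $c\ge 0$ such that every $J$-subdivision-free graph $G$ with $\omega(G)\le\kappa$ and $\chi^{2|V(J)|+7}(G)\le\tau$ satisfies $\chi(G)\le c$. -/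

import Mathlib

open scoped Graph

universe w u v v'

/-! Multigraphs are Mathlib's `Graph α β`, a structure with vertex set `V(H)`, edge set `E(H)` and
`H.IsLink e x y` saying that `e` is an edge with ends `x, y`.  Graphs are Mathlib's `SimpleGraph`
on a finite vertex type. -/

/-- `J` is obtained from the multigraph `H` by replacing each edge `e` with ends `x, y` by a
subgraph `B e` of `J` which satisfies `R e (B e) (φ x) (φ y)`.  Here `φ` places the vertices of `H`
in `J`; the subgraphs `B e` are disjoint except for the ends of the edges, and together with the
vertices of `H` they make up the whole of `J`. -/
structure IsEdgeReplacement {α : Type u} {β : Type v} {W : Type w} (H : Graph α β)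
    (J : SimpleGraph W) (R : β → J.Subgraph → W → W → Prop) (φ : α → W) (B : β → J.Subgraph) :
    Prop where
  injOn : Set.InjOn φ V(H)
  replaces : ∀ e x y, H.IsLink e x y → R e (B e) (φ x) (φ y)
  /-- `B e` contains no vertices of `H` other than the ends of `e`. -/
  inc_of_mem : ∀ e ∈ E(H), ∀ x ∈ V(H), φ x ∈ (B e).verts → H.Inc e x
  /-- For distinct edges, the subgraphs meet only in common ends of the edges. -/
  common_end : ∀ e ∈ E(H), ∀ f ∈ E(H), e ≠ f → ∀ a ∈ (B e).verts, a ∈ (B f).verts →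
    ∃ x, H.Inc e x ∧ H.Inc f x ∧ φ x = a
  /-- For distinct edges, the subgraphs have no common edge (`J` has no parallel edges, so two
  distinct edges of `H` cannot both be represented by the same edge of `J`). -/
  edge_disjoint : ∀ e ∈ E(H), ∀ f ∈ E(H), e ≠ f → Disjoint (B e).edgeSet (B f).edgeSet
  cover_verts : ∀ a : W, (∃ x ∈ V(H), φ x = a) ∨ ∃ e ∈ E(H), a ∈ (B e).verts
  cover_adj : ∀ a b : W, J.Adj a b → ∃ e ∈ E(H), (B e).Adj a b

/-- The subgraph `P` is a path of length at least one with ends `s, t`. -/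
def IsPathSubgraph {W : Type w} {J : SimpleGraph W} (P : J.Subgraph) (s t : W) : Prop :=
  ∃ p : J.Walk s t, p.IsPath ∧ 0 < p.length ∧ P = p.toSubgraph

/-- The subgraph `P` consists of a single edge with ends `s, t`. -/
def IsEdgeSubgraph {W : Type w} {J : SimpleGraph W} (P : J.Subgraph) (s t : W) : Prop :=
  ∃ h : J.Adj s t, P = J.subgraphOfAdj h

/-- The subgraph `P` is a banana with ends `s, t`: the union of a nonempty set of paths of positive
length, all with ends `s, t` and otherwise disjoint. -/
def IsBananaSubgraph {W : Type w} {J : SimpleGraph W} (P : J.Subgraph) (s t : W) : Prop :=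
  ∃ S : Set (J.Walk s t), S.Nonempty ∧ (∀ p ∈ S, p.IsPath ∧ 0 < p.length) ∧
    (∀ p ∈ S, ∀ q ∈ S, p ≠ q → ∀ a ∈ p.support, a ∈ q.support → a = s ∨ a = t) ∧
    P = ⨆ p ∈ S, p.toSubgraph

/-- The graph `J` is a subdivision of the (loopless) multigraph `H`. -/
def IsSubdivisionOf {α : Type u} {β : Type v} {W : Type w} (J : SimpleGraph W) (H : Graph α β) :
    Prop :=
  ∃ (φ : α → W) (B : β → J.Subgraph), IsEdgeReplacement H J (fun _ => IsPathSubgraph) φ B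

/-- The graph `G` is `H`-subdivision-free: no induced subgraph of `G` is a subdivision of `H`. -/
def SubdivisionFree {α : Type u} {β : Type v} {V : Type w} (H : Graph α β) (G : SimpleGraph V) :
    Prop :=
  ∀ X : Set V, ¬ IsSubdivisionOf (G.induce X) H

/-- `χ^ρ(G)`: the maximum over all vertices `a` of the chromatic number of the subgraph induced on
the set of vertices at distance at most `ρ` from `a` (zero if there are no vertices). -/
noncomputable def localChromaticNumber {V : Type w} (ρ : ℕ) (G : SimpleGraph V) : ℕ∞ :=
  ⨆ a : V, (G.induce {b | G.edist a b ≤ (ρ : ℕ∞)}).chromaticNumber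

/-- A class of finite graphs. -/
def GraphClass : Type (w + 1) := ∀ (V : Type w) [Finite V], SimpleGraph V → Prop

/-- An ideal: a class of finite graphs closed under (graphs isomorphic to) induced subgraphs.
`G ↪g G'` is the type of isomorphisms of `G` onto induced subgraphs of `G'`. -/
def GraphClass.IsIdeal (C : GraphClass.{w}) : Prop :=
  ∀ (V V' : Type w) [Finite V] [Finite V'] (G : SimpleGraph V) (G' : SimpleGraph V'),
    Nonempty (G ↪g G') → C V' G' → C V G

/-- All members of the class have chromatic number at most some constant. -/
def GraphClass.Colourable (C : GraphClass.{w}) : Prop :=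
  ∃ k : ℕ, ∀ (V : Type w) [Finite V] (G : SimpleGraph V), C V G → G.chromaticNumber ≤ k

/-- There exists `τ` such that `χ^ρ(G) ≤ τ` for all members `G` of the class. -/
def GraphClass.Bounded (ρ : ℕ) (C : GraphClass.{w}) : Prop :=
  ∃ τ : ℕ, ∀ (V : Type w) [Finite V] (G : SimpleGraph V), C V G → localChromaticNumber ρ G ≤ τ

/-- The multigraph `H` is widespread: for every subdivision `J` of `H` and all `κ` there exists `ρ`
such that every `ρ`-bounded ideal of `J`-subdivision-free graphs `G` with `ω(G) ≤ κ` is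
colourable.  The graph `J` is viewed as a multigraph by `Graph.ofSimpleGraph`. -/
def Widespread {α : Type u} {β : Type v} (H : Graph α β) : Prop :=
  ∀ (W : Type w) [Finite W] (J : SimpleGraph W), IsSubdivisionOf J H → ∀ κ : ℕ, ∃ ρ : ℕ,
    ∀ C : GraphClass.{w}, C.IsIdeal →
      (∀ (V : Type w) [Finite V] (G : SimpleGraph V), C V G →
        SubdivisionFree (Graph.ofSimpleGraph J) G ∧ G.cliqueNum ≤ κ) →
      C.Bounded ρ → C.Colourable

/-- The multigraph `C` is a cycle of length `m` (two parallel edges if `m = 2`; loops are not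
allowed). -/
def IsCycleMultigraph {α : Type u} {β : Type v} (C : Graph α β) (m : ℕ) : Prop :=
  2 ≤ m ∧ ∃ (x : ZMod m → α) (e : ZMod m → β), Function.Injective x ∧ Function.Injective e ∧
    V(C) = Set.range x ∧ E(C) = Set.range e ∧ ∀ i, C.IsLink (e i) (x i) (x (i + 1))

/-- `H` is obtained from the multigraph `C` by fattening the edges in `F`, that is, by replacing
each of them by a nonempty set of parallel edges with the same ends.  The map `π` sends every edge
of `H` to the edge of `C` that it comes from. -/
def IsFattening {α : Type u} {β : Type v} {γ : Type v'} (C : Graph α β) (F : Set β)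
    (H : Graph α γ) : Prop :=
  V(H) = V(C) ∧ ∃ π : γ → β,
    (∀ f x y, H.IsLink f x y → C.IsLink (π f) x y) ∧
    (∀ e ∈ E(C), ∃ f ∈ E(H), π f = e) ∧
    (∀ e ∈ E(C), e ∉ F → ∃! f, f ∈ E(H) ∧ π f = e)

/-- The graph `J` is obtained from the multigraph `C` by substituting bananas for all of its edges
except the edge `e₀` (which remains an edge). -/
def IsBananaSubstitution {α : Type u} {β : Type v} {W : Type w} (C : Graph α β) (e₀ : β)
    (J : SimpleGraph W) : Prop :=
  ∃ (φ : α → W) (B : β → J.Subgraph), IsEdgeReplacement C J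
    (fun e P s t => (e = e₀ → IsEdgeSubgraph P s t) ∧ (e ≠ e₀ → IsBananaSubgraph P s t)) φ B

/-! Both statements concern a graph `J` that is a union of internally disjoint strands along a
cycle, with a single strand on one link. Suppose that cliques and the chromatic numbers of balls are
bounded while the chromatic number is huge. Then there is a `Necklace`: `m` vertices pairwise far
apart, consecutive ones joined through `k` pairwise anticomplete connected sets (one set for the
last pair), each set touching no other of the `m` vertices. A shortest path through each set is
chordless, and it is long because its ends are far apart. These paths induce a graph of the same
shape as `J` with longer strands, which is a subdivision of `J` (`StrandSystem.exists_bound`).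

To find a necklace, search breadth-first in a set of large chromatic number (`exists_base`). This
gives a base: a connected top `T`, the next level `L`, and, two levels below `L`, a set of large
chromatic number, each of whose vertices `z` has a parent `h z`, its hub, between it and `L`. Repeat
the search inside that set. For some older base, the new connected set `U = T ∪ L` may be touched by
the hubs of a set of large chromatic number; then `U` becomes a route on that base. Otherwise the
offending vertices are deleted and `U` starts a new, clean base (`BaseSystem.step`). After boundedly
many rounds there are many bases, or many routes on one base.

With many bases, Ramsey's theorem and the clique bound supply, for each vertex, `m * k` bases with
pairwise nonadjacent hubs. By pigeonhole, `m` far apart vertices share these bases, and each base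
yields one connecting set (`BaseSystem.exists_necklace`).

With many routes on one base, the necklace consists of hubs of successively chosen centres. A route
touches the hubs of all remaining vertices, so it has to be cut. Grow a connected piece from a
neighbour of the current hub until the vertices whose hubs touch the piece first have large
chromatic number (`exists_separates`). The last step adds only vertices in a ball of radius two, so
many vertices are still missed. The next centre is taken among the touched vertices, and the search
continues among the missed ones. Back from the last centre to the first, the top of the base
provides one link only; this is where the unfattened edge is used (`exists_necklace_of_progress`).
-/

/-! ### Colourings, connectedness and anticomplete sets. -/

/-- The vertices in `s` can be properly coloured with the colours `0, …, n - 1`. -/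
def ColOn {V : Type w} (G : SimpleGraph V) (s : Set V) (n : ℕ) : Prop :=
  ∃ f : V → ℕ, (∀ a ∈ s, f a < n) ∧ ∀ a ∈ s, ∀ b ∈ s, G.Adj a b → f a ≠ f b

/-- The set `s` is nonempty and induces a connected subgraph. -/
def ConnOn {V : Type w} (G : SimpleGraph V) (s : Set V) : Prop :=
  s.Nonempty ∧ ∀ X ⊆ s, X.Nonempty → (∀ a ∈ X, ∀ b ∈ s, G.Adj a b → b ∈ X) → s ⊆ X

/-- The vertex `v` has a neighbour in `S`. -/
def Touch {V : Type w} (G : SimpleGraph V) (v : V) (S : Set V) : Prop :=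
  ∃ a ∈ S, G.Adj v a

/-- The sets `X` and `Y` are disjoint and there are no edges between them. -/
def Anti {V : Type w} (G : SimpleGraph V) (X Y : Set V) : Prop :=
  ∀ a ∈ X, ∀ b ∈ Y, a ≠ b ∧ ¬ G.Adj a b

section Basics

variable {V : Type w} {G : SimpleGraph V}

theorem ColOn.mono {s t : Set V} {m n : ℕ} (h : ColOn G t m) (hs : s ⊆ t) (hn : m ≤ n) :
    ColOn G s n := by
  obtain ⟨f, h1, h2⟩ := h
  exact ⟨f, fun a ha => (h1 a (hs ha)).trans_le hn, fun a ha b hb => h2 a (hs ha) b (hs hb)⟩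

theorem ColOn.empty (n : ℕ) : ColOn G ∅ n := ⟨fun _ => 0, by simp, by simp⟩

theorem ColOn.union {s t : Set V} {m n : ℕ} (hs : ColOn G s m) (ht : ColOn G t n) :
    ColOn G (s ∪ t) (m + n) := by
  classical
  obtain ⟨f, f1, f2⟩ := hs
  obtain ⟨g, g1, g2⟩ := ht
  refine ⟨fun a => if a ∈ s then f a else m + g a, ?_, ?_⟩
  · intro a ha
    by_cases has : a ∈ s
    · have := f1 a has; simp [has]; omega
    · have := g1 a (ha.resolve_left has); simp [has]; omega
  · intro a ha b hb hab
    by_cases has : a ∈ s <;> by_cases hbs : b ∈ s <;> simp only [has, hbs, if_true, if_false]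
    · exact f2 a has b hbs hab
    · have := f1 a has; omega
    · have := f1 b hbs; omega
    · have := g2 a (ha.resolve_left has) b (hb.resolve_left hbs) hab; omega

theorem ColOn.biUnion {s : ℕ → Set V} {N : ℕ} (r : ℕ) (h : ∀ i < r, ColOn G (s i) N) :
    ColOn G {a | ∃ i < r, a ∈ s i} (r * N) := by
  induction r with
  | zero => exact (ColOn.empty _).mono (by simp) le_rfl
  | succ r ih =>
    rw [Nat.succ_mul]
    refine ((ih fun i hi => h i (by omega)).union (h r (by omega))).mono ?_ le_rfl
    rintro a ⟨i, hi, ha⟩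
    rcases Nat.lt_succ_iff_lt_or_eq.1 hi with h' | rfl
    · exact Or.inl ⟨i, h', ha⟩
    · exact Or.inr ha

theorem not_colOn_diff {A s : Set V} {M N : ℕ} (hA : ¬ ColOn G A (M + N)) (hs : ColOn G s N) :
    ¬ ColOn G (A \ s) M := fun h =>
  hA ((h.union hs).mono (fun a ha => by by_cases h : a ∈ s <;> simp [h, ha]) le_rfl)

theorem nonempty_of_not_colOn {A : Set V} {M : ℕ} (hA : ¬ ColOn G A M) : A.Nonempty := by
  rw [Set.nonempty_iff_ne_empty]
  rintro rfl
  exact hA (ColOn.empty _)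

theorem ColOn.of_colorable {s : Set V} {n : ℕ} (h : (G.induce s).Colorable n) : ColOn G s n := by
  classical
  obtain ⟨c⟩ := h
  refine ⟨fun a => if ha : a ∈ s then (c ⟨a, ha⟩ : ℕ) else 0, ?_, ?_⟩
  · intro a ha; simp [ha]
  · intro a ha b hb hab
    simp only [ha, hb, dif_pos]
    intro h
    have : (G.induce s).Adj ⟨a, ha⟩ ⟨b, hb⟩ := hab
    exact c.valid this (Fin.ext h)

theorem ColOn.colorable {n : ℕ} (h : ColOn G Set.univ n) : G.Colorable n := by
  obtain ⟨f, h1, h2⟩ := h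
  exact ⟨SimpleGraph.Coloring.mk (fun a => ⟨f a, h1 a trivial⟩) (fun {a b} hab h =>
    h2 a trivial b trivial hab (by simpa using h))⟩

theorem Anti.symm {X Y : Set V} (h : Anti G X Y) : Anti G Y X :=
  fun a ha b hb => ⟨(h b hb a ha).1.symm, fun hab => (h b hb a ha).2 hab.symm⟩

theorem Anti.mono {X Y X' Y' : Set V} (h : Anti G X Y) (hX : X' ⊆ X) (hY : Y' ⊆ Y) :
    Anti G X' Y' := fun a ha b hb => h a (hX ha) b (hY hb)

theorem Touch.mono {v : V} {S T : Set V} (h : Touch G v S) (hs : S ⊆ T) : Touch G v T := by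
  obtain ⟨a, ha, h⟩ := h
  exact ⟨a, hs ha, h⟩

theorem touch_insert {v a : V} {S : Set V} :
    Touch G v (insert a S) ↔ G.Adj v a ∨ Touch G v S := by
  constructor
  · rintro ⟨b, rfl | hb, h⟩
    · exact Or.inl h
    · exact Or.inr ⟨b, hb, h⟩
  · rintro (h | ⟨b, hb, h⟩)
    · exact ⟨a, Or.inl rfl, h⟩
    · exact ⟨b, Or.inr hb, h⟩

theorem ConnOn.singleton (a : V) : ConnOn G {a} := by
  refine ⟨⟨a, rfl⟩, fun X hX ⟨b, hb⟩ _ => ?_⟩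
  have := hX hb
  rw [Set.mem_singleton_iff] at this
  rintro c rfl
  exact this ▸ hb

theorem ConnOn.insert_vertex {a : V} {S : Set V} (h : ConnOn G S) (ha : Touch G a S) :
    ConnOn G (insert a S) := by
  obtain ⟨b, hb, hab⟩ := ha
  refine ⟨⟨a, Or.inl rfl⟩, fun X hX hne hcl => ?_⟩
  have key : b ∈ X → insert a S ⊆ X := by
    intro hbX
    have : S ⊆ X ∩ S := h.2 (X ∩ S) Set.inter_subset_right ⟨b, hbX, hb⟩
      (fun c hc d hd hcd => ⟨hcl c hc.1 d (Or.inr hd) hcd, hd⟩)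
    rintro c (rfl | hc)
    · exact hcl b hbX c (Or.inl rfl) hab.symm
    · exact (this hc).1
  obtain ⟨c, hc⟩ := hne
  rcases hX hc with rfl | hcS
  · exact key (hcl c hc b (Or.inr hb) hab)
  · have : S ⊆ X ∩ S := h.2 (X ∩ S) Set.inter_subset_right ⟨c, hc, hcS⟩
      (fun c hc d hd hcd => ⟨hcl c hc.1 d (Or.inr hd) hcd, hd⟩)
    exact key (this hb).1

/-- A proper nonempty subset of a connected set has a neighbour in the rest. -/
theorem ConnOn.exists_extend {S X : Set V} (h : ConnOn G S) (hX : X ⊆ S) (hne : X.Nonempty)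
    (hS : ¬ S ⊆ X) : ∃ a ∈ S, a ∉ X ∧ Touch G a X := by
  by_contra hcon
  push Not at hcon
  refine hS (h.2 X hX hne fun a ha b hb hab => ?_)
  by_contra hbX
  exact hcon b hb hbX ⟨a, ha, hab.symm⟩

/-- A set in which every vertex is joined to `r` by a chain of predecessors is connected. -/
theorem connOn_of_pred {S : Set V} (lev : V → ℕ) (r : V) (hr : r ∈ S)
    (hp : ∀ a ∈ S, a ≠ r → ∃ b ∈ S, G.Adj a b ∧ lev b < lev a) : ConnOn G S := by
  refine ⟨⟨r, hr⟩, fun X hX ⟨a, ha⟩ hcl => ?_⟩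
  have key : ∀ n, ∀ a ∈ S, lev a = n → (a ∈ X ↔ r ∈ X) := by
    intro n
    induction n using Nat.strong_induction_on with
    | _ n ih =>
      intro a haS hn
      by_cases har : a = r
      · rw [har]
      · obtain ⟨b, hb, hab, hl⟩ := hp a haS har
        rw [← ih (lev b) (hn ▸ hl) b hb rfl]
        exact ⟨fun h => hcl a h b hb hab, fun h => hcl b h a haS hab.symm⟩
  intro b hb
  exact (key _ b hb rfl).2 ((key _ a (hX ha) rfl).1 ha)

/-- A minimal subset that is not `M`-colourable is connected: a proper part closed under adjacency
and its complement would both be `M`-colourable, and with no edges between them they could use the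
same colours. -/
theorem exists_connOn_not_colOn [Finite V] {A : Set V} {M : ℕ} (hA : ¬ ColOn G A M) :
    ∃ A' ⊆ A, ConnOn G A' ∧ ¬ ColOn G A' M := by
  classical
  obtain ⟨A', ⟨hA', hM⟩, hmin⟩ := (Set.toFinite {s : Set V | s ⊆ A ∧ ¬ ColOn G s M}).exists_minimal
    ⟨A, subset_rfl, hA⟩
  refine ⟨A', hA', ⟨nonempty_of_not_colOn hM, fun X hX hne hcl => ?_⟩, hM⟩
  by_contra hs
  have h1 : ColOn G X M := by
    by_contra h
    exact hs (hmin ⟨hX.trans hA', h⟩ hX)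
  have h2 : ColOn G (A' \ X) M := by
    by_contra h
    obtain ⟨a, ha⟩ := hne
    exact (hmin ⟨Set.sdiff_subset.trans hA', h⟩ Set.sdiff_subset (hX ha)).2 ha
  obtain ⟨f, f1, f2⟩ := h1
  obtain ⟨g, g1, g2⟩ := h2
  refine hM ⟨fun a => if a ∈ X then f a else g a, fun a ha => ?_, fun a ha b hb hab => ?_⟩
  · by_cases h : a ∈ X
    · simpa [h] using f1 a h
    · simpa [h] using g1 a ⟨ha, h⟩
  · by_cases h : a ∈ X <;> by_cases h' : b ∈ X <;> simp only [h, h', if_true, if_false]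
    · exact f2 a h b h' hab
    · exact (h' (hcl a h b hb hab)).elim
    · exact (h (hcl b h' a ha hab.symm)).elim
    · exact g2 a ⟨ha, h⟩ b ⟨hb, h'⟩ hab

/-! ### Breadth-first search and bases. -/

/-- Breadth-first levels of a connected set. -/
theorem ConnOn.exists_levels {A : Set V} (hA : ConnOn G A) {r : V} (hr : r ∈ A) :
    ∃ lev : V → ℕ, lev r = 0 ∧ (∀ a ∈ A, lev a = 0 → a = r) ∧
      (∀ a ∈ A, ∀ b ∈ A, G.Adj a b → lev a ≤ lev b + 1) ∧
      (∀ a ∈ A, ∀ n, lev a = n + 1 → ∃ b ∈ A, G.Adj a b ∧ lev b = n) := by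
  let H : SimpleGraph V :=
    { Adj := fun a b => G.Adj a b ∧ a ∈ A ∧ b ∈ A
      symm := ⟨fun a b h => ⟨h.1.symm, h.2.2, h.2.1⟩⟩
      loopless := ⟨fun a h => G.loopless.irrefl a h.1⟩ }
  have hreach : ∀ a ∈ A, H.Reachable r a := by
    have := hA.2 {a | a ∈ A ∧ H.Reachable r a} (fun a h => h.1) ⟨r, hr, .refl r⟩
      (fun a ha b hb hab => ⟨hb, ha.2.trans (SimpleGraph.Adj.reachable ⟨hab, ha.1, hb⟩)⟩)
    exact fun a ha => (this ha).2
  have hadj : ∀ a b, H.Adj a b → H.dist r a ≤ H.dist r b + 1 := by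
    intro a b hab
    obtain ⟨p, hp⟩ := (hreach b hab.2.2).exists_walk_length_eq_dist
    rw [← hp, ← SimpleGraph.Walk.length_concat p hab.symm]
    exact SimpleGraph.dist_le _
  refine ⟨fun a => H.dist r a, by simp, fun a ha h => ?_,
    fun a ha b hb hab => hadj a b ⟨hab, ha, hb⟩, fun a ha n hn => ?_⟩
  · exact ((hreach a ha).dist_eq_zero_iff.1 h).symm
  · obtain ⟨p, hp⟩ := (hreach a ha).symm.exists_walk_length_eq_dist
    rw [SimpleGraph.dist_comm] at hp
    simp only at hn
    cases p with
    | nil => simp at hn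
    | @cons _ b _ hab q =>
      refine ⟨b, hab.2.2, hab.1, ?_⟩
      have h1 := SimpleGraph.dist_le q.reverse
      have h2 := hadj a b hab
      rw [SimpleGraph.Walk.length_cons] at hp
      rw [SimpleGraph.Walk.length_reverse] at h1
      change H.dist r b = n
      omega

/-- A base for attaching routes inside `B`: the set `T ∪ L` plays the role of the top of a
breadth-first search, and `h z` is the parent of `z ∈ B`. -/
structure BaseOK (G : SimpleGraph V) (T L : Set V) (h : V → V) (B : Set V) : Prop where
  connT : ConnOn G T
  connU : ConnOn G (T ∪ L)
  touch_T : ∀ l ∈ L, Touch G l T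
  adj : ∀ z ∈ B, G.Adj z (h z)
  touch_L : ∀ z ∈ B, Touch G (h z) L
  -- Hubs reach the base through `L` only, so a set made of `T` and a few chosen vertices of `L` is
  -- touched by few hubs.
  not_touch_T : ∀ z ∈ B, ¬ Touch G (h z) T
  hub_notMem_T : ∀ z ∈ B, h z ∉ T
  hub_notMem_L : ∀ z ∈ B, h z ∉ L
  hub_notMem : ∀ z ∈ B, h z ∉ B
  anti : Anti G B (T ∪ L)

theorem BaseOK.mono {T L B B' : Set V} {h : V → V} (H : BaseOK G T L h B) (hB : B' ⊆ B) :
    BaseOK G T L h B' where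
  connT := H.connT
  connU := H.connU
  touch_T := H.touch_T
  adj z hz := H.adj z (hB hz)
  touch_L z hz := H.touch_L z (hB hz)
  not_touch_T z hz := H.not_touch_T z (hB hz)
  hub_notMem_T z hz := H.hub_notMem_T z (hB hz)
  hub_notMem_L z hz := H.hub_notMem_L z (hB hz)
  hub_notMem z hz h := H.hub_notMem z (hB hz) (hB h)
  anti := H.anti.mono hB subset_rfl

/-- In a set of large chromatic number there is a base together with a set of large chromatic
number attached to it. -/
theorem exists_base [Finite V] {τ : ℕ} (hτ : ∀ a, ColOn G {b | G.edist a b ≤ 2} τ) {A : Set V}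
    {N : ℕ} (hA : ¬ ColOn G A (2 * N + τ)) :
    ∃ (T L F : Set V) (h : V → V), T ⊆ A ∧ L ⊆ A ∧ F ⊆ A ∧ (∀ z ∈ F, h z ∈ A) ∧
      ¬ ColOn G F N ∧ BaseOK G T L h F := by
  classical
  obtain ⟨A', hA', hconn, hbig⟩ := exists_connOn_not_colOn hA
  obtain ⟨r, hr⟩ := hconn.1
  obtain ⟨lev, h0, h0', hadj, hpred⟩ := hconn.exists_levels hr
  -- Otherwise levels up to 2, which lie in a ball about `r`, take `τ` colours, and the other levels
  -- alternate between two palettes of `N` colours according to parity. The shift by 3 leaves room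
  -- above the chosen level for the hubs, `L` and a nonempty `T`.
  have hex : ∃ n, ¬ ColOn G {a | a ∈ A' ∧ lev a = n + 3} N := by
    by_contra hcon
    push Not at hcon
    choose f f1 f2 using hcon
    obtain ⟨g, g1, g2⟩ := hτ r
    have hball : ∀ a ∈ A', lev a ≤ 2 → G.edist r a ≤ 2 := by
      have : ∀ n, ∀ a ∈ A', lev a = n → G.edist r a ≤ n := by
        intro n
        induction n with
        | zero => intro a ha hl; rw [h0' a ha hl]; simp
        | succ n ih =>
          intro a ha hl
          obtain ⟨b, hb, hab, hlb⟩ := hpred a ha n hl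
          calc G.edist r a ≤ G.edist r b + G.edist b a := G.edist_triangle
            _ ≤ n + 1 := add_le_add (ih b hb hlb)
              (le_of_eq (SimpleGraph.edist_eq_one_iff_adj.2 hab.symm))
            _ = ((n + 1 : ℕ) : ℕ∞) := by simp
      intro a ha hl
      exact (this _ a ha rfl).trans (by exact_mod_cast hl)
    refine hbig ⟨fun a => if lev a ≤ 2 then g a else
      τ + ((lev a % 2) * N + f (lev a - 3) a), ?_, ?_⟩
    · intro a ha
      by_cases hl : lev a ≤ 2
      · have := g1 a (hball a ha hl)
        simp only [hl, if_true]; omega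
      · have := f1 (lev a - 3) a ⟨ha, by omega⟩
        simp only [hl, if_false]
        rcases Nat.mod_two_eq_zero_or_one (lev a) with h | h <;> rw [h] <;> omega
    · intro a ha b hb hab
      by_cases hl : lev a ≤ 2 <;> by_cases hl' : lev b ≤ 2 <;>
        simp only [hl, hl', if_true, if_false]
      · exact g2 a (hball a ha hl) b (hball b hb hl') hab
      · have := g1 a (hball a ha hl); omega
      · have := g1 b (hball b hb hl'); omega
      · have e1 := f1 (lev a - 3) a ⟨ha, by omega⟩
        have e2 := f1 (lev b - 3) b ⟨hb, by omega⟩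
        by_cases heq : lev a = lev b
        · have := f2 (lev a - 3) a ⟨ha, by omega⟩ b ⟨hb, by omega⟩ hab
          rw [heq] at this ⊢
          omega
        · have l1 := hadj a ha b hb hab
          have l2 := hadj b hb a ha hab.symm
          rcases Nat.mod_two_eq_zero_or_one (lev a) with h | h <;>
            rcases Nat.mod_two_eq_zero_or_one (lev b) with h' | h' <;> rw [h, h'] <;> omega
  obtain ⟨n, hn⟩ := hex
  have hpar : ∀ z, ∃ b, z ∈ A' → lev z = n + 3 → b ∈ A' ∧ G.Adj z b ∧ lev b = n + 2 := by
    intro z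
    by_cases hz : z ∈ A' ∧ lev z = n + 3
    · obtain ⟨b, hb⟩ := hpred z hz.1 (n + 2) hz.2
      exact ⟨b, fun _ _ => hb⟩
    · exact ⟨z, fun h h' => (hz ⟨h, h'⟩).elim⟩
  choose h hh using hpar
  have hle : ∀ k, ConnOn G {a | a ∈ A' ∧ lev a ≤ k} := by
    intro k
    refine connOn_of_pred lev r ⟨hr, by omega⟩ ?_
    rintro a ⟨ha, hl⟩ har
    obtain ⟨c, hc⟩ := Nat.exists_eq_succ_of_ne_zero (fun h => har (h0' a ha h))
    obtain ⟨b, hb, hab, hlb⟩ := hpred a ha c hc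
    exact ⟨b, ⟨hb, by omega⟩, hab, by omega⟩
  have hU : {a | a ∈ A' ∧ lev a ≤ n} ∪ {a | a ∈ A' ∧ lev a = n + 1} =
      {a | a ∈ A' ∧ lev a ≤ n + 1} := by
    ext a
    simp only [Set.mem_union, Set.mem_ofPred_eq]
    constructor
    · rintro (h | h) <;> exact ⟨h.1, by omega⟩
    · rintro ⟨h, h'⟩
      rcases Nat.le_succ_iff.1 h' with h'' | h''
      · exact Or.inl ⟨h, h''⟩
      · exact Or.inr ⟨h, h''⟩
  refine ⟨{a | a ∈ A' ∧ lev a ≤ n}, {a | a ∈ A' ∧ lev a = n + 1}, {a | a ∈ A' ∧ lev a = n + 3}, h,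
    fun a ha => hA' ha.1, fun a ha => hA' ha.1, fun a ha => hA' ha.1,
    fun z hz => hA' (hh z hz.1 hz.2).1, hn, ?_⟩
  constructor
  · exact hle n
  · rw [hU]; exact hle (n + 1)
  · rintro l ⟨hl, hl'⟩
    obtain ⟨b, hb, hab, hlb⟩ := hpred l hl n hl'
    exact ⟨b, ⟨hb, hlb.le⟩, hab⟩
  · exact fun z hz => (hh z hz.1 hz.2).2.1
  · intro z hz
    obtain ⟨h1, h2, h3⟩ := hh z hz.1 hz.2
    obtain ⟨b, hb, hab, hlb⟩ := hpred _ h1 (n + 1) h3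
    exact ⟨b, ⟨hb, hlb⟩, hab⟩
  · rintro z hz ⟨t, ⟨ht, ht'⟩, hzt⟩
    obtain ⟨h1, h2, h3⟩ := hh z hz.1 hz.2
    have := hadj _ h1 t ht hzt
    omega
  · rintro z hz ⟨_, h'⟩
    have := (hh z hz.1 hz.2).2.2
    omega
  · rintro z hz ⟨_, h'⟩
    have := (hh z hz.1 hz.2).2.2
    omega
  · rintro z hz ⟨_, h'⟩
    have := (hh z hz.1 hz.2).2.2
    omega
  · rw [hU]
    rintro a ⟨ha, ha'⟩ b ⟨hb, hb'⟩
    refine ⟨?_, fun hab => ?_⟩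
    · rintro rfl; omega
    · have := hadj a ha b hb hab
      omega

end Basics

/-! ### Routes and centres on a single base. -/

/-- The threshold `N ↦ 2 N + τ` iterated `n` times. -/
def splitBound (τ : ℕ) : ℕ → ℕ → ℕ
  | 0, N => N
  | n + 1, N => splitBound τ n (2 * N + τ)

theorem le_splitBound (τ n N : ℕ) : N ≤ splitBound τ n N := by
  induction n generalizing N with
  | zero => exact le_rfl
  | succ n ih => exact le_trans (by omega) (ih (2 * N + τ))

/-- The connected part `X` of `Y` is attached to `v` and to the hubs of `P`, but not to the hubs
of `Q`. -/
structure Separates {V : Type w} (G : SimpleGraph V) (h : V → V) (v : V) (P Q Y X : Set V) :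
    Prop where
  conn : ConnOn G X
  subset : X ⊆ Y
  touch_start : Touch G v X
  touch : ∀ z ∈ P, Touch G (h z) X
  not_touch : ∀ z ∈ Q, ¬ Touch G (h z) X

/-- `k` routes for every link of a cyclic chain of `m` links, except that there is only one route
for the last link. -/
def ValidLink (m k i j : ℕ) : Prop := (i + 1 < m ∧ j < k) ∨ (i + 1 = m ∧ j = 0)

/-- A cyclic chain of hubs that are pairwise far apart, in which consecutive hubs are joined
through pairwise anticomplete connected sets. -/
structure Necklace {V : Type w} (G : SimpleGraph V) (m k D : ℕ) (v : ℕ → V)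
    (S : ℕ → ℕ → Set V) : Prop where
  conn : ∀ i j, ValidLink m k i j → ConnOn G (S i j)
  touch_left : ∀ i j, ValidLink m k i j → Touch G (v i) (S i j)
  touch_right : ∀ i j, ValidLink m k i j → Touch G (v ((i + 1) % m)) (S i j)
  not_touch : ∀ i j, ValidLink m k i j → ∀ l < m, l ≠ i → l ≠ (i + 1) % m →
    ¬ Touch G (v l) (S i j)
  notMem : ∀ i j, ValidLink m k i j → ∀ l < m, v l ∉ S i j
  anti : ∀ i j i' j', ValidLink m k i j → ValidLink m k i' j' → (i ≠ i' ∨ j ≠ j') →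
    Anti G (S i j) (S i' j')
  far : ∀ l < m, ∀ l' < m, l ≠ l' → (D : ℕ∞) < G.edist (v l) (v l')

/-- Routes `Y c` and centres `x i` collected on a base with hubs `h`, together with the links
`S i j` between consecutive hubs of centres; everything is anticomplete to what is to be found
in `A` later on. -/
structure Progress {V : Type w} (G : SimpleGraph V) (h : V → V) (B : Set V) (ρ k : ℕ) (A : Set V)
    (n w : ℕ) (x : ℕ → V) (Y : ℕ → Set V) (σ : ℕ → ℕ → ℕ) (S : ℕ → ℕ → Set V) : Prop where
  le : n * (2 * k) ≤ w
  subset : A ⊆ B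
  centre_mem : ∀ i < n, x i ∈ B
  centre_far : ∀ i < n, ∀ z ∈ A, (ρ : ℕ∞) < G.edist (x i) z
  centres_far : ∀ i < n, ∀ j < n, i ≠ j → (ρ : ℕ∞) < G.edist (x i) (x j)
  conn : ∀ c < w, ConnOn G (Y c)
  route_subset : ∀ c < w, Y c ⊆ B
  anti : ∀ c < w, Anti G (Y c) A
  routes_anti : ∀ c < w, ∀ c' < w, c ≠ c' → Anti G (Y c) (Y c')
  -- Routes come in batches of `2 * k`, and centre `i` is chosen when batches `0, …, i` are
  -- complete. So these are the routes found after centre `i`.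
  not_touch_later : ∀ c < w, ∀ i < n, (i + 1) * (2 * k) ≤ c → ¬ Touch G (h (x i)) (Y c)
  -- The condition says that `c` belongs to batch `n - 1` or later. Batch `n - 1` is the one from
  -- which links out of the newest centre will be cut; earlier batches have been cut already.
  touch : ∀ c < w, n * (2 * k) ≤ c + 2 * k → ∀ z ∈ A, Touch G (h z) (Y c)
  touch_last : ∀ c < w, n * (2 * k) ≤ c + 2 * k → c < n * (2 * k) → ∀ i, i + 1 = n →
    Touch G (h (x i)) (Y c)
  link_conn : ∀ i j, i + 1 < n → j < k → ConnOn G (S i j)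
  link_subset : ∀ i j, i + 1 < n → j < k → S i j ⊆ Y (σ i j)
  le_link : ∀ i j, i + 1 < n → j < k → i * (2 * k) ≤ σ i j
  link_lt : ∀ i j, i + 1 < n → j < k → σ i j < (i + 1) * (2 * k)
  link_inj : ∀ i j j', i + 1 < n → j < k → j' < k → σ i j = σ i j' → j = j'
  link_left : ∀ i j, i + 1 < n → j < k → Touch G (h (x i)) (S i j)
  link_right : ∀ i j, i + 1 < n → j < k → Touch G (h (x (i + 1))) (S i j)
  link_later : ∀ i j, i + 1 < n → j < k → ∀ l < n, i + 1 < l → ¬ Touch G (h (x l)) (S i j)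
  link_not_touch : ∀ i j, i + 1 < n → j < k → ∀ z ∈ A, ¬ Touch G (h z) (S i j)

section Routes

variable {V : Type w} {G : SimpleGraph V}

theorem Separates.mono {h : V → V} {v : V} {P Q P' Q' Y X : Set V} (H : Separates G h v P Q Y X)
    (hP : P' ⊆ P) (hQ : Q' ⊆ Q) : Separates G h v P' Q' Y X :=
  ⟨H.conn, H.subset, H.touch_start, fun z hz => H.touch z (hP hz),
    fun z hz => H.not_touch z (hQ hz)⟩

/-- Take a maximal connected `X` in `Y`, containing a fixed neighbour of `v`, such that the vertices
of `P`, and likewise those of `Q`, with hubs touching `X` are `N`-colourable. It is not all of `Y`,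
since all hubs touch `Y`. Adding one more vertex breaks the bound on one side, whereas on the other
side the touched part needs at most `N + τ` colours, so more than `N` are needed for what remains.
-/
theorem exists_separates [Finite V] {h : V → V} {v : V} {P Q Y : Set V} {N τ : ℕ} (hτN : τ ≤ N)
    (hτ : ∀ u, ColOn G {z | G.Adj (h z) u ∧ z ∈ P ∪ Q} τ)
    (hP : ¬ ColOn G P (2 * N + τ)) (hQ : ¬ ColOn G Q (2 * N + τ)) (hY : ConnOn G Y)
    (hv : Touch G v Y) (ht : ∀ z ∈ P ∪ Q, Touch G (h z) Y) :
    ∃ X P' Q', P' ⊆ P ∧ Q' ⊆ Q ∧ ¬ ColOn G P' N ∧ ¬ ColOn G Q' N ∧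
      (Separates G h v P' Q' Y X ∨ Separates G h v Q' P' Y X) := by
  classical
  obtain ⟨a, haY, hva⟩ := hv
  let R : Set V → Set V → Set V := fun P X => {z | z ∈ P ∧ Touch G (h z) X}
  have hR : ∀ Z ⊆ P ∪ Q, ∀ u X M, ColOn G (R Z X) M → ColOn G (R Z (insert u X)) (M + τ) := by
    intro Z hZ u X M hM
    refine (hM.union (hτ u)).mono ?_ le_rfl
    rintro z ⟨hz, hz'⟩
    rcases touch_insert.1 hz' with h' | h'
    · exact Or.inr ⟨h', hZ hz⟩
    · exact Or.inl ⟨hz, h'⟩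
  have hR0 : ∀ Z ⊆ P ∪ Q, ColOn G (R Z {a}) N := by
    intro Z hZ
    refine (hτ a).mono ?_ hτN
    rintro z ⟨hz, b, rfl, hb⟩
    exact ⟨hb, hZ hz⟩
  obtain ⟨X, ⟨hXY, hXc, haX, hXP, hXQ⟩, hmax⟩ := (Set.toFinite {X : Set V | X ⊆ Y ∧ ConnOn G X ∧
    a ∈ X ∧ ColOn G (R P X) N ∧ ColOn G (R Q X) N}).exists_maximal ⟨{a},
      Set.singleton_subset_iff.2 haY, .singleton a, rfl,
      hR0 P Set.subset_union_left, hR0 Q Set.subset_union_right⟩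
  have hYX : ¬ Y ⊆ X := by
    intro hYX
    refine hP (hXP.mono (fun z hz => ⟨hz, (ht z (Or.inl hz)).mono hYX⟩) (by omega))
  obtain ⟨u, huY, huX, hut⟩ := hY.exists_extend hXY ⟨a, haX⟩ hYX
  have hX'Y : insert u X ⊆ Y := Set.insert_subset huY hXY
  have hX'c : ConnOn G (insert u X) := hXc.insert_vertex hut
  have hP' := hR P Set.subset_union_left u X N hXP
  have hQ' := hR Q Set.subset_union_right u X N hXQ
  have hor : ¬ ColOn G (R P (insert u X)) N ∨ ¬ ColOn G (R Q (insert u X)) N := by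
    by_contra hcon
    push Not at hcon
    exact huX (hmax ⟨hX'Y, hX'c, Or.inr haX, hcon.1, hcon.2⟩ (Set.subset_insert u X)
      (Or.inl rfl))
  have htv : Touch G v (insert u X) := ⟨a, Or.inr haX, hva⟩
  rcases hor with hb | hb
  · exact ⟨insert u X, R P (insert u X), Q \ R Q (insert u X), fun z hz => hz.1,
      Set.sdiff_subset, hb,
      not_colOn_diff (M := N) (fun hc => hQ (hc.mono subset_rfl (by omega))) hQ',
      Or.inl ⟨hX'c, hX'Y, htv, fun z hz => hz.2, fun z hz hz' => hz.2 ⟨hz.1, hz'⟩⟩⟩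
  · exact ⟨insert u X, P \ R P (insert u X), R Q (insert u X), Set.sdiff_subset,
      fun z hz => hz.1,
      not_colOn_diff (M := N) (fun hc => hP (hc.mono subset_rfl (by omega))) hP', hb,
      Or.inr ⟨hX'c, hX'Y, htv, fun z hz => hz.2, fun z hz hz' => hz.2 ⟨hz.1, hz'⟩⟩⟩

theorem exists_separates_all [Finite V] {h : V → V} {v : V} {A : Set V} {Y : ℕ → Set V}
    {N τ : ℕ} (hτN : τ ≤ N) (hτ : ∀ u, ColOn G {z | G.Adj (h z) u ∧ z ∈ A} τ) (K : ℕ)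
    (hA : ¬ ColOn G A (splitBound τ K N)) (hY : ∀ c < K, ConnOn G (Y c))
    (hv : ∀ c < K, Touch G v (Y c)) (ht : ∀ c < K, ∀ z ∈ A, Touch G (h z) (Y c)) :
    ∃ (P Q : Set V) (X : ℕ → Set V), P ⊆ A ∧ Q ⊆ A ∧ ¬ ColOn G P N ∧ ¬ ColOn G Q N ∧
      ∀ c < K, Separates G h v P Q (Y c) (X c) ∨ Separates G h v Q P (Y c) (X c) := by
  classical
  induction K generalizing N with
  -- The two sides may overlap, so both can start as the whole of `A`.
  | zero => exact ⟨A, A, Y, subset_rfl, subset_rfl, hA, hA, by simp⟩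
  | succ K ih =>
    obtain ⟨P, Q, X, hP, hQ, hPN, hQN, hsep⟩ := ih (N := 2 * N + τ) (by omega) hA
      (fun c hc => hY c (by omega)) (fun c hc => hv c (by omega)) (fun c hc => ht c (by omega))
    obtain ⟨X', P', Q', hP', hQ', hPN', hQN', hs⟩ := exists_separates (Y := Y K) hτN
      (fun u => (hτ u).mono (fun z hz => ⟨hz.1, Set.union_subset hP hQ hz.2⟩) le_rfl) hPN hQN
      (hY K (by omega)) (hv K (by omega)) (fun z hz => ht K (by omega) z (Set.union_subset hP hQ hz))
    refine ⟨P', Q', Function.update X K X', hP'.trans hP, hQ'.trans hQ, hPN', hQN', ?_⟩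
    intro c hc
    rcases Nat.lt_succ_iff_lt_or_eq.1 hc with h' | rfl
    · rw [Function.update_of_ne h'.ne]
      exact (hsep c h').imp (·.mono hP' hQ') (·.mono hQ' hP')
    · rw [Function.update_self]
      exact hs

theorem exists_index_enumeration {K k : ℕ} {p : ℕ → Prop} [DecidablePred p]
    (h : k ≤ ((Finset.range K).filter p).card) :
    ∃ σ : ℕ → ℕ, (∀ j < k, σ j < K ∧ p (σ j)) ∧ ∀ j < k, ∀ j' < k, σ j = σ j' → j = j' := by
  obtain ⟨s, hs, hc⟩ := Finset.exists_subset_card_eq h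
  refine ⟨fun j => if hj : j < k then s.orderEmbOfFin hc ⟨j, hj⟩ else 0, ?_, ?_⟩
  · intro j hj
    have := hs (s.orderEmbOfFin_mem hc ⟨j, hj⟩)
    simpa [hj] using this
  · intro j hj j' hj' he
    simpa [hj, hj'] using he

/-- Each of the `2 * k` pieces favours one of the two sides; `k` of them agree, and that side is
named `P`. -/
theorem exists_separates_half [Finite V] {h : V → V} {v : V} {A : Set V} {Y : ℕ → Set V}
    {N τ : ℕ} (hτN : τ ≤ N) (hτ : ∀ u, ColOn G {z | G.Adj (h z) u ∧ z ∈ A} τ) (k : ℕ)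
    (hA : ¬ ColOn G A (splitBound τ (2 * k) N)) (hY : ∀ c < 2 * k, ConnOn G (Y c))
    (hv : ∀ c < 2 * k, Touch G v (Y c)) (ht : ∀ c < 2 * k, ∀ z ∈ A, Touch G (h z) (Y c)) :
    ∃ (P Q : Set V) (X : ℕ → Set V) (σ : ℕ → ℕ), P ⊆ A ∧ Q ⊆ A ∧ ¬ ColOn G P N ∧ ¬ ColOn G Q N ∧
      (∀ j < k, σ j < 2 * k ∧ Separates G h v P Q (Y (σ j)) (X j)) ∧
      ∀ j < k, ∀ j' < k, σ j = σ j' → j = j' := by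
  classical
  obtain ⟨P, Q, X, hP, hQ, hPN, hQN, hsep⟩ := exists_separates_all hτN hτ (2 * k) hA hY hv ht
  have hcard : ((Finset.range (2 * k)).filter fun c => Separates G h v P Q (Y c) (X c)).card +
      ((Finset.range (2 * k)).filter fun c => ¬ Separates G h v P Q (Y c) (X c)).card = 2 * k := by
    rw [Finset.card_filter_add_card_filter_not, Finset.card_range]
  by_cases hk : k ≤ ((Finset.range (2 * k)).filter fun c =>
      Separates G h v P Q (Y c) (X c)).card
  · obtain ⟨σ, h1, h2⟩ := exists_index_enumeration hk
    exact ⟨P, Q, fun j => X (σ j), σ, hP, hQ, hPN, hQN, h1, h2⟩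
  · obtain ⟨σ, h1, h2⟩ := exists_index_enumeration (K := 2 * k) (k := k)
      (p := fun c => ¬ Separates G h v P Q (Y c) (X c)) (by omega)
    exact ⟨Q, P, fun j => X (σ j), σ, hQ, hP, hQN, hPN,
      fun j hj => ⟨(h1 j hj).1, (hsep _ (h1 j hj).1).resolve_left (h1 j hj).2⟩, h2⟩

/-- All these vertices lie within distance two of `u`, through their hubs. -/
theorem colOn_fibre {h : V → V} {A : Set V} {τ : ℕ} (hτ : ∀ a, ColOn G {b | G.edist a b ≤ 2} τ)
    (hadj : ∀ z ∈ A, G.Adj z (h z)) (u : V) : ColOn G {z | G.Adj (h z) u ∧ z ∈ A} τ := by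
  refine (hτ u).mono ?_ le_rfl
  rintro z ⟨hz, hzA⟩
  calc G.edist u z ≤ G.edist u (h z) + G.edist (h z) z := G.edist_triangle
    _ = 1 + 1 := by
      rw [SimpleGraph.edist_eq_one_iff_adj.2 hz.symm,
        SimpleGraph.edist_eq_one_iff_adj.2 (hadj z hzA).symm]
    _ ≤ 2 := by norm_num

theorem Progress.mono {h : V → V} {B A A' : Set V} {ρ k n w : ℕ} {x : ℕ → V} {Y : ℕ → Set V}
    {σ : ℕ → ℕ → ℕ} {S : ℕ → ℕ → Set V} (H : Progress G h B ρ k A n w x Y σ S) (hA : A' ⊆ A) :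
    Progress G h B ρ k A' n w x Y σ S where
  __ := H
  subset := hA.trans H.subset
  centre_far i hi z hz := H.centre_far i hi z (hA hz)
  anti c hc := (H.anti c hc).mono subset_rfl hA
  touch c hc hc' z hz := H.touch c hc hc' z (hA hz)
  link_not_touch i j hi hj z hz := H.link_not_touch i j hi hj z (hA hz)

theorem Progress.zero {h : V → V} {B A : Set V} (ρ k : ℕ) (hA : A ⊆ B) (x : ℕ → V) :
    Progress G h B ρ k A 0 0 x (fun _ => ∅) (fun _ _ => 0) (fun _ _ => ∅) where
  le := by simp
  subset := hA
  centre_mem := by simp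
  centre_far := by simp
  centres_far := by simp
  conn := by simp
  route_subset := by simp
  anti := by simp
  routes_anti := by simp
  not_touch_later := by simp
  touch := by simp
  touch_last := by simp
  link_conn := by simp
  link_subset := by simp
  le_link := by simp
  link_lt := by simp
  link_inj := by simp
  link_left := by simp
  link_right := by simp
  link_later := by simp
  link_not_touch := by simp

/-- The new route lies in `A`, to which the old routes are anticomplete. It misses the hubs of the
old centres because a vertex adjacent to `h (x i)` is within distance two of `x i`, while `A` is
farther away. -/
theorem Progress.append {h : V → V} {B A A' U : Set V} {ρ k n w : ℕ} {x : ℕ → V}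
    {Y : ℕ → Set V} {σ : ℕ → ℕ → ℕ} {S : ℕ → ℕ → Set V} (H : Progress G h B ρ k A n w x Y σ S)
    (hρ : 2 ≤ ρ) (hadj : ∀ z ∈ B, G.Adj z (h z)) (hA : A' ⊆ A) (hUA : U ⊆ A) (hU : ConnOn G U)
    (hanti : Anti G U A') (ht : ∀ z ∈ A', Touch G (h z) U) :
    Progress G h B ρ k A' n (w + 1) x (Function.update Y w U) σ S := by
  have H' := H.mono hA
  have hw : Function.update Y w U w = U := Function.update_self ..
  have hne : ∀ c, c < w → Function.update Y w U c = Y c := fun c hc =>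
    Function.update_of_ne hc.ne ..
  have hcases : ∀ c, c < w + 1 → c < w ∨ c = w := fun c hc => by omega
  have hlink : ∀ i j, i + 1 < n → j < k → σ i j < w := by
    intro i j hi hj
    refine (H.link_lt i j hi hj).trans_le (le_trans ?_ H.le)
    gcongr
  refine { H' with
    le := H.le.trans (by omega)
    conn := fun c hc => ?_
    route_subset := fun c hc => ?_
    anti := fun c hc => ?_
    routes_anti := fun c hc c' hc' hcc => ?_
    not_touch_later := fun c hc i hi hic => ?_
    touch := fun c hc hnc z hz => ?_
    touch_last := fun c hc h1 h2 i hi => ?_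
    link_subset := fun i j hi hj => ?_ }
  · rcases hcases c hc with h' | rfl
    · rw [hne c h']; exact H.conn c h'
    · rw [hw]; exact hU
  · rcases hcases c hc with h' | rfl
    · rw [hne c h']; exact H.route_subset c h'
    · rw [hw]; exact hUA.trans H.subset
  · rcases hcases c hc with h' | rfl
    · rw [hne c h']; exact H'.anti c h'
    · rw [hw]; exact hanti
  · rcases hcases c hc with h' | rfl <;> rcases hcases c' hc' with h'' | rfl
    · rw [hne c h', hne c' h'']; exact H.routes_anti c h' c' h'' hcc
    · rw [hne c h', hw]; exact (H.anti c h').mono subset_rfl hUA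
    · rw [hne c' h'', hw]; exact ((H.anti c' h'').mono subset_rfl hUA).symm
    · exact (hcc rfl).elim
  · rcases hcases c hc with h' | rfl
    · rw [hne c h']; exact H.not_touch_later c h' i hi hic
    · rw [hw]
      rintro ⟨a, ha, hxa⟩
      have h1 := H.centre_far i hi a (hUA ha)
      have h2 : G.edist (x i) a ≤ 1 + 1 := by
        refine (G.edist_triangle (v := h (x i))).trans ?_
        rw [SimpleGraph.edist_eq_one_iff_adj.2 hxa,
          SimpleGraph.edist_eq_one_iff_adj.2 (hadj _ (H.centre_mem i hi))]
      exact absurd (h1.trans_le (h2.trans (by norm_num; exact hρ))) (lt_irrefl _)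
  · rcases hcases c hc with h' | rfl
    · rw [hne c h']; exact H'.touch c h' hnc z hz
    · rw [hw]; exact ht z hz
  · have : c < w := h2.trans_le H.le
    rw [hne c this]; exact H.touch_last c this h1 h2 i hi
  · rw [hne _ (hlink i j hi hj)]; exact H.link_subset i j hi hj

/-- The routes of batch `n - 1` touch the hub of the newest centre and the hubs of all of `A`. They
are cut into pieces that are touched from `P` and missed from `Q`. Any `y` in `P` can be the next
centre, and the search goes on in `Q` outside the ball about `y`; deleting this ball costs the extra
`τ`. -/
theorem Progress.exists_centre [Finite V] {h : V → V} {B A : Set V} {ρ k n w N τ : ℕ}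
    {x : ℕ → V} {Y : ℕ → Set V} {σ : ℕ → ℕ → ℕ} {S : ℕ → ℕ → Set V}
    (H : Progress G h B ρ k A n w x Y σ S) (hw : (n + 1) * (2 * k) = w) (hρ : 2 ≤ ρ)
    (hτ : ∀ a, ColOn G {b | G.edist a b ≤ ρ} τ) (hadj : ∀ z ∈ B, G.Adj z (h z))
    (hA : ¬ ColOn G A (splitBound τ (2 * k) (N + τ))) :
    ∃ (A' : Set V) (x' : ℕ → V) (σ' : ℕ → ℕ → ℕ) (S' : ℕ → ℕ → Set V), A' ⊆ A ∧
      ¬ ColOn G A' N ∧ Progress G h B ρ k A' (n + 1) w x' Y σ' S' := by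
  have hρ' : (2 : ℕ∞) ≤ ρ := by exact_mod_cast hρ
  have hτ2 : ∀ a, ColOn G {b | G.edist a b ≤ 2} τ := fun a =>
    (hτ a).mono (fun b hb => le_trans hb hρ') le_rfl
  have hsplit : ∃ (P Q : Set V) (X : ℕ → Set V) (s : ℕ → ℕ), P ⊆ A ∧ Q ⊆ A ∧ P.Nonempty ∧
      ¬ ColOn G Q (N + τ) ∧ ∀ i, i + 1 = n →
      (∀ j < k, s j < 2 * k ∧ Separates G h (h (x i)) P Q (Y (i * (2 * k) + s j)) (X j)) ∧
      ∀ j < k, ∀ j' < k, s j = s j' → j = j' := by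
    -- The first centre has no predecessor to be linked to, so nothing is cut.
    rcases n with _ | i
    · exact ⟨A, A, fun _ => ∅, fun _ => 0, subset_rfl, subset_rfl, nonempty_of_not_colOn hA,
        fun hc => hA (hc.mono subset_rfl (le_splitBound _ _ _)), by simp⟩
    · have e1 : (i + 1) * (2 * k) = i * (2 * k) + 2 * k := by ring
      have e2 : (i + 1 + 1) * (2 * k) = i * (2 * k) + 2 * k + 2 * k := by ring
      obtain ⟨P, Q, X, s, hP, hQ, hPN, hQN, h1, h2⟩ := exists_separates_half (v := h (x i))
        (Y := fun c => Y (i * (2 * k) + c)) (by omega : τ ≤ N + τ)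
        (colOn_fibre hτ2 (fun z hz => hadj z (H.subset hz))) k hA
        (fun c hc => H.conn _ (by omega))
        (fun c hc => H.touch_last _ (by omega) (by omega) (by omega) i rfl)
        (fun c hc => H.touch _ (by omega) (by omega))
      refine ⟨P, Q, X, s, hP, hQ, nonempty_of_not_colOn hPN, hQN, ?_⟩
      rintro i' hi'
      obtain rfl : i' = i := by omega
      exact ⟨h1, h2⟩
  obtain ⟨P, Q, X, s, hP, hQ, ⟨y, hy⟩, hQN, hs⟩ := hsplit
  have hyA := hP hy
  have H' := H.mono hQ
  have hsub : Q \ {b | G.edist y b ≤ ρ} ⊆ Q := Set.sdiff_subset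
  have H'' := H'.mono hsub
  have hxn : Function.update x n y n = y := Function.update_self ..
  have hxne : ∀ i, i < n → Function.update x n y i = x i := fun i hi =>
    Function.update_of_ne hi.ne ..
  have hcases : ∀ i, i < n + 1 → i < n ∨ i = n := fun i hi => by omega
  have hcases' : ∀ i, i + 1 < n + 1 → i + 1 < n ∨ i + 1 = n := fun i hi => by omega
  refine ⟨Q \ {b | G.edist y b ≤ ρ}, Function.update x n y,
    fun i j => if i + 1 = n then i * (2 * k) + s j else σ i j,
    fun i j => if i + 1 = n then X j else S i j, hsub.trans hQ, not_colOn_diff hQN (hτ y), ?_⟩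
  refine { H'' with
    le := hw.le
    centre_mem := fun i hi => ?_
    centre_far := fun i hi z hz => ?_
    centres_far := fun i hi j hj hij => ?_
    not_touch_later := fun c hc i hi hic => ?_
    touch := fun c hc hnc z hz => H''.touch c hc (le_trans (by gcongr; omega) hnc) z hz
    touch_last := fun c hc h1 h2 i hi => ?_
    link_conn := fun i j hi hj => ?_
    link_subset := fun i j hi hj => ?_
    le_link := fun i j hi hj => ?_
    link_lt := fun i j hi hj => ?_
    link_inj := fun i j j' hi hj hj' he => ?_
    link_left := fun i j hi hj => ?_
    link_right := fun i j hi hj => ?_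
    link_later := fun i j hi hj l hl hil => ?_
    link_not_touch := fun i j hi hj z hz => ?_ }
  · rcases hcases i hi with h' | rfl
    · rw [hxne i h']; exact H.centre_mem i h'
    · rw [hxn]; exact H.subset hyA
  · rcases hcases i hi with h' | rfl
    · rw [hxne i h']; exact H''.centre_far i h' z hz
    · rw [hxn]; exact not_le.1 hz.2
  · rcases hcases i hi with h' | rfl <;> rcases hcases j hj with h'' | rfl
    · rw [hxne i h', hxne j h'']; exact H.centres_far i h' j h'' hij
    · rw [hxne i h', hxn]; exact H.centre_far i h' y hyA
    · rw [hxne j h'', hxn, SimpleGraph.edist_comm]; exact H.centre_far j h'' y hyA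
    · exact (hij rfl).elim
  · rcases hcases i hi with h' | rfl
    · rw [hxne i h']; exact H.not_touch_later c hc i h' hic
    · omega
  · obtain rfl : i = n := by omega
    rw [hxn]
    refine H.touch c hc ?_ y hyA
    have : (i + 1) * (2 * k) = i * (2 * k) + 2 * k := by ring
    omega
  · rcases hcases' i hi with h' | h'
    · simp only [h'.ne, if_false]; exact H.link_conn i j h' hj
    · simp only [h', if_true]; exact ((hs i h').1 j hj).2.conn
  · rcases hcases' i hi with h' | h'
    · simp only [h'.ne, if_false]; exact H.link_subset i j h' hj
    · simp only [h', if_true]; exact ((hs i h').1 j hj).2.subset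
  · rcases hcases' i hi with h' | h'
    · simp only [h'.ne, if_false]; exact H.le_link i j h' hj
    · simp only [h', if_true]; omega
  · rcases hcases' i hi with h' | h'
    · simp only [h'.ne, if_false]; exact H.link_lt i j h' hj
    · have := ((hs i h').1 j hj).1
      have e : (i + 1) * (2 * k) = i * (2 * k) + 2 * k := by ring
      simp only [h', if_true]; rw [← h', e]; omega
  · rcases hcases' i hi with h' | h'
    · simp only [h'.ne, if_false] at he; exact H.link_inj i j j' h' hj hj' he
    · simp only [h', if_true] at he; exact (hs i h').2 j hj j' hj' (by omega)
  · rw [hxne i (by omega)]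
    rcases hcases' i hi with h' | h'
    · simp only [h'.ne, if_false]; exact H.link_left i j h' hj
    · simp only [h', if_true]; exact ((hs i h').1 j hj).2.touch_start
  · rcases hcases' i hi with h' | h'
    · rw [hxne _ h']; simp only [h'.ne, if_false]; exact H.link_right i j h' hj
    · simp only [h', if_true, hxn]; exact ((hs i h').1 j hj).2.touch y hy
  · have h' : i + 1 < n := by omega
    simp only [h'.ne, if_false]
    rcases hcases l hl with hl' | rfl
    · rw [hxne l hl']; exact H.link_later i j h' hj l hl' hil
    · rw [hxn]; exact H.link_not_touch i j h' hj y hyA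
  · rcases hcases' i hi with h' | h'
    · simp only [h'.ne, if_false]; exact H''.link_not_touch i j h' hj z hz
    · simp only [h', if_true]; exact ((hs i h').1 j hj).2.not_touch z hz.1

/-- There are `w` routes on the base with hubs `h`, and accordingly `w / (2 k)` centres. -/
def HasProgress (G : SimpleGraph V) (h : V → V) (B : Set V) (ρ k : ℕ) (A : Set V) (w : ℕ) :
    Prop :=
  ∃ x Y σ S, Progress G h B ρ k A (w / (2 * k)) w x Y σ S

theorem HasProgress.mono {h : V → V} {B A A' : Set V} {ρ k w : ℕ}
    (H : HasProgress G h B ρ k A w) (hA : A' ⊆ A) : HasProgress G h B ρ k A' w := by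
  obtain ⟨x, Y, σ, S, H⟩ := H
  exact ⟨x, Y, σ, S, H.mono hA⟩

/-- The number `w / (2 * k)` of centres changes exactly when the new route completes a batch, and
then a centre has to be chosen at once. -/
theorem HasProgress.succ [Finite V] {h : V → V} {B A A' U : Set V} {ρ k w N τ : ℕ}
    (H : HasProgress G h B ρ k A w) (hρ : 2 ≤ ρ)
    (hτ : ∀ a, ColOn G {b | G.edist a b ≤ ρ} τ) (hadj : ∀ z ∈ B, G.Adj z (h z)) (hA : A' ⊆ A)
    (hUA : U ⊆ A) (hU : ConnOn G U) (hanti : Anti G U A') (ht : ∀ z ∈ A', Touch G (h z) U)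
    (hA' : ¬ ColOn G A' (splitBound τ (2 * k) (N + τ))) :
    ∃ A'' ⊆ A', ¬ ColOn G A'' N ∧ HasProgress G h B ρ k A'' (w + 1) := by
  obtain ⟨x, Y, σ, S, H⟩ := H
  have H1 := H.append hρ hadj hA hUA hU hanti ht
  by_cases hd : 2 * k ∣ w + 1
  · have hdiv : (w + 1) / (2 * k) = w / (2 * k) + 1 := Nat.succ_div_of_dvd hd
    obtain ⟨A'', x', σ', S', h1, h2, h3⟩ := H1.exists_centre
      (by rw [← hdiv]; exact Nat.div_mul_cancel hd) hρ hτ hadj hA'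
    exact ⟨A'', h1, h2, x', _, σ', S', by rwa [hdiv]⟩
  · have hdiv : (w + 1) / (2 * k) = w / (2 * k) := Nat.succ_div_of_not_dvd hd
    refine ⟨A', subset_rfl, fun hc => hA' (hc.mono subset_rfl ?_), x, _, σ, S, by rwa [hdiv]⟩
    exact le_trans (by omega) (le_splitBound τ (2 * k) (N + τ))

theorem lt_edist_of_adj {D : ℕ} {a b a' b' : V} (h : ((D + 2 : ℕ) : ℕ∞) < G.edist a b)
    (ha : G.Adj a a') (hb : G.Adj b b') : (D : ℕ∞) < G.edist a' b' := by
  by_contra hcon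
  have h1 : G.edist a b ≤ G.edist a a' + (G.edist a' b' + G.edist b' b) :=
    G.edist_triangle.trans (by gcongr; exact G.edist_triangle)
  rw [SimpleGraph.edist_eq_one_iff_adj.2 ha, SimpleGraph.edist_eq_one_iff_adj.2 hb.symm] at h1
  have h2 : (1 : ℕ∞) + (G.edist a' b' + 1) ≤ 1 + (D + 1) := by
    gcongr
    exact not_lt.1 hcon
  have h3 := h.trans_le (h1.trans h2)
  rw [show ((D + 2 : ℕ) : ℕ∞) = 1 + ((D : ℕ∞) + 1) by push_cast; ring] at h3
  exact lt_irrefl _ h3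

/-- The hubs of the first `m` centres form the necklace. Links between successive centres are the
pieces cut from the routes, and the last link runs through the top of the base. -/
theorem exists_necklace_of_progress {T L B A : Set V} {h : V → V} {ρ k m D w : ℕ}
    (hb : BaseOK G T L h B) (hm : 2 ≤ m) (hk : 0 < k) (hD : 2 ≤ D) (hρ : D + 2 ≤ ρ)
    (H : HasProgress G h B ρ k A w) (hw : m * (2 * k) ≤ w) :
    ∃ v S, Necklace G m k D v S := by
  obtain ⟨x, Y, σ, S, H⟩ := H
  have hn : m ≤ w / (2 * k) := (Nat.le_div_iff_mul_le (by omega)).2 hw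
  set n := w / (2 * k)
  have hfar : ∀ l < m, ∀ l' < m, l ≠ l' → (D : ℕ∞) < G.edist (h (x l)) (h (x l')) := by
    intro l hl l' hl' hne
    refine lt_edist_of_adj (lt_of_le_of_lt ?_ (H.centres_far l (by omega) l' (by omega) hne))
      (hb.adj _ (H.centre_mem l (by omega))) (hb.adj _ (H.centre_mem l' (by omega)))
    exact_mod_cast hρ
  have hex : ∀ l, ∃ t, l < m → t ∈ L ∧ G.Adj (h (x l)) t := by
    intro l
    by_cases hl : l < m
    · obtain ⟨t, ht⟩ := hb.touch_L _ (H.centre_mem l (by omega))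
      exact ⟨t, fun _ => ht⟩
    · exact ⟨x 0, fun h => (hl h).elim⟩
  choose t ht' using hex
  have htL := fun l hl => (ht' l hl).1
  have ht := fun l hl => (ht' l hl).2
  have hmemB : ∀ i j, i + 1 < m → j < k → S i j ⊆ B ∧ σ i j < w := by
    intro i j hi hj
    have h1 : σ i j < w := by
      refine (H.link_lt i j (by omega) hj).trans_le (le_trans ?_ H.le)
      gcongr
      omega
    exact ⟨(H.link_subset i j (by omega) hj).trans (H.route_subset _ h1), h1⟩
  -- Only the first and last hubs may touch the closing link, so of `L` it contains just one
  -- neighbour of each; the other hubs miss `T`, and they are too far away to be adjacent to these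
  -- two vertices.
  let C : Set V := insert (t 0) (insert (t (m - 1)) T)
  have hCU : C ⊆ T ∪ L := by
    rintro a (rfl | rfl | ha)
    · exact Or.inr (htL 0 (by omega))
    · exact Or.inr (htL _ (by omega))
    · exact Or.inl ha
  let S' : ℕ → ℕ → Set V := fun i j => if i + 1 = m then C else S i j
  have hlast : ∀ i j, i + 1 = m → S' i j = C := fun i j hi => by simp [S', hi]
  have hlt : ∀ i j, i + 1 < m → S' i j = S i j := fun i j hi => by simp [S', hi.ne]
  have hadjt : ∀ l < m, ∀ l' < m, l ≠ l' → ¬ G.Adj (h (x l)) (t l') := by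
    intro l hl l' hl' hne hadj
    have h1 := hfar l hl l' hl' hne
    have h2 : G.edist (h (x l)) (h (x l')) ≤ 1 + 1 := by
      refine (G.edist_triangle (v := t l')).trans ?_
      rw [SimpleGraph.edist_eq_one_iff_adj.2 hadj,
        SimpleGraph.edist_eq_one_iff_adj.2 (ht l' hl').symm]
    exact absurd (h1.trans_le (h2.trans (by norm_num; exact hD))) (lt_irrefl _)
  have hCB : Anti G B C := hb.anti.mono subset_rfl hCU
  refine ⟨fun l => h (x l), S', ?_⟩
  constructor
  · rintro i j (⟨hi, hj⟩ | ⟨hi, hj⟩)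
    · rw [hlt i j hi]; exact H.link_conn i j (by omega) hj
    · rw [hlast i j hi]
      exact (hb.connT.insert_vertex (hb.touch_T _ (htL _ (by omega)))).insert_vertex
        ((hb.touch_T _ (htL _ (by omega))).mono (Set.subset_insert _ _))
  · rintro i j (⟨hi, hj⟩ | ⟨hi, hj⟩)
    · rw [hlt i j hi]; exact H.link_left i j (by omega) hj
    · rw [hlast i j hi]
      refine ⟨t i, ?_, ht i (by omega)⟩
      rw [show i = m - 1 by omega]
      exact Or.inr (Or.inl rfl)
  · rintro i j (⟨hi, hj⟩ | ⟨hi, hj⟩)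
    · rw [hlt i j hi, Nat.mod_eq_of_lt hi]; exact H.link_right i j (by omega) hj
    · rw [hlast i j hi, hi, Nat.mod_self]
      exact ⟨t 0, Or.inl rfl, ht 0 (by omega)⟩
  · rintro i j (⟨hi, hj⟩ | ⟨hi, hj⟩) l hl hli hli'
    · rw [hlt i j hi]
      rw [Nat.mod_eq_of_lt hi] at hli'
      -- Hubs of earlier centres miss the whole route; hubs of later ones touch the route but miss
      -- the piece cut from it.
      rcases lt_or_gt_of_ne hli with h' | h'
      · intro htt
        refine H.not_touch_later (σ i j) (hmemB i j hi hj).2 l (by omega) ?_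
          (htt.mono (H.link_subset i j (by omega) hj))
        refine le_trans ?_ (H.le_link i j (by omega) hj)
        gcongr
        omega
      · exact H.link_later i j (by omega) hj l (by omega) (by omega)
    · rw [hlast i j hi]
      rw [hi, Nat.mod_self] at hli'
      intro htt
      rcases touch_insert.1 htt with h' | h'
      · exact hadjt l hl 0 (by omega) hli' h'
      rcases touch_insert.1 h' with h' | h'
      · exact hadjt l hl (m - 1) (by omega) (by omega) h'
      · exact hb.not_touch_T _ (H.centre_mem l (by omega)) h'
  · rintro i j (⟨hi, hj⟩ | ⟨hi, hj⟩) l hl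
    · rw [hlt i j hi]
      exact fun hmem => hb.hub_notMem _ (H.centre_mem l (by omega)) ((hmemB i j hi hj).1 hmem)
    · rw [hlast i j hi]
      intro hmem
      rcases hCU hmem with h' | h'
      · exact hb.hub_notMem_T _ (H.centre_mem l (by omega)) h'
      · exact hb.hub_notMem_L _ (H.centre_mem l (by omega)) h'
  · rintro i j i' j' (⟨hi, hj⟩ | ⟨hi, hj⟩) (⟨hi', hj'⟩ | ⟨hi', hj'⟩) hne
    · rw [hlt i j hi, hlt i' j' hi']
      refine (H.routes_anti _ (hmemB i j hi hj).2 _ (hmemB i' j' hi' hj').2 ?_).mono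
        (H.link_subset i j (by omega) hj) (H.link_subset i' j' (by omega) hj')
      intro he
      have a1 := H.le_link i j (by omega) hj
      have a2 := H.link_lt i j (by omega) hj
      have b1 := H.le_link i' j' (by omega) hj'
      have b2 := H.link_lt i' j' (by omega) hj'
      have c1 : i = i' := by
        have := lt_of_mul_lt_mul_right (a1.trans_lt (he ▸ b2)) (Nat.zero_le _)
        have := lt_of_mul_lt_mul_right (b1.trans_lt (he ▸ a2)) (Nat.zero_le _)
        omega
      subst c1
      exact hne.elim (fun h => h rfl) (fun h => h (H.link_inj i j j' (by omega) hj hj' he))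
    · rw [hlt i j hi, hlast i' j' hi']
      exact hCB.mono (hmemB i j hi hj).1 subset_rfl
    · rw [hlast i j hi, hlt i' j' hi']
      exact (hCB.mono (hmemB i' j' hi' hj').1 subset_rfl).symm
    · omega
  · exact hfar

end Routes

/-! ### Ramsey's theorem. -/

/-- Ramsey's theorem for graphs. -/
theorem exists_ramsey (a b : ℕ) : ∃ R : ℕ, ∀ (r : ℕ → ℕ → Prop), (∀ i j, r i j → r j i) →
    ∀ s : Finset ℕ, R ≤ s.card →
      (∃ t ⊆ s, t.card = a ∧ ∀ i ∈ t, ∀ j ∈ t, i ≠ j → r i j) ∨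
      (∃ t ⊆ s, t.card = b ∧ ∀ i ∈ t, ∀ j ∈ t, i ≠ j → ¬ r i j) := by
  classical
  induction a generalizing b with
  | zero => exact ⟨0, fun r _ s _ => Or.inl ⟨∅, by simp⟩⟩
  | succ a iha =>
    induction b with
    | zero => exact ⟨0, fun r _ s _ => Or.inr ⟨∅, by simp⟩⟩
    | succ b ihb =>
      obtain ⟨R1, h1⟩ := iha (b + 1)
      obtain ⟨R2, h2⟩ := ihb
      -- Some `x` has at least `R1` related or at least `R2` unrelated elements in the rest; it is
      -- added to the set found among them.
      refine ⟨R1 + R2 + 1, fun r hr s hs => ?_⟩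
      obtain ⟨x, hx⟩ := Finset.card_pos.1 (by omega : 0 < s.card)
      have hcard : ((s.erase x).filter (r x)).card +
          ((s.erase x).filter fun y => ¬ r x y).card = s.card - 1 := by
        rw [Finset.card_filter_add_card_filter_not, Finset.card_erase_of_mem hx]
      have hsub : ∀ (p : ℕ → Prop) [DecidablePred p], (s.erase x).filter p ⊆ s := fun p _ =>
        (Finset.filter_subset _ _).trans (Finset.erase_subset _ _)
      have hcases : R1 ≤ ((s.erase x).filter (r x)).card ∨
          R2 ≤ ((s.erase x).filter fun y => ¬ r x y).card := by omega
      rcases hcases with hc | hc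
      · rcases h1 r hr _ hc with ⟨t, ht, htc, htr⟩ | ⟨t, ht, htc, htr⟩
        · have hxt : ∀ y ∈ t, y ≠ x ∧ r x y := by
            intro y hy
            have := ht hy
            simp only [Finset.mem_filter, Finset.mem_erase] at this
            exact ⟨this.1.1, this.2⟩
          refine Or.inl ⟨insert x t, Finset.insert_subset hx (ht.trans (hsub _)), ?_, ?_⟩
          · rw [Finset.card_insert_of_notMem (fun h => (hxt x h).1 rfl), htc]
          · intro i hi j hj hij
            rcases Finset.mem_insert.1 hi with rfl | hi' <;>
              rcases Finset.mem_insert.1 hj with rfl | hj'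
            · exact (hij rfl).elim
            · exact (hxt j hj').2
            · exact hr _ _ (hxt i hi').2
            · exact htr i hi' j hj' hij
        · exact Or.inr ⟨t, ht.trans (hsub _), htc, htr⟩
      · rcases h2 r hr _ hc with ⟨t, ht, htc, htr⟩ | ⟨t, ht, htc, htr⟩
        · exact Or.inl ⟨t, ht.trans (hsub _), htc, htr⟩
        · have hxt : ∀ y ∈ t, y ≠ x ∧ ¬ r x y := by
            intro y hy
            have := ht hy
            simp only [Finset.mem_filter, Finset.mem_erase] at this
            exact ⟨this.1.1, this.2⟩
          refine Or.inr ⟨insert x t, Finset.insert_subset hx (ht.trans (hsub _)), ?_, ?_⟩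
          · rw [Finset.card_insert_of_notMem (fun h => (hxt x h).1 rfl), htc]
          · intro i hi j hj hij
            rcases Finset.mem_insert.1 hi with rfl | hi' <;>
              rcases Finset.mem_insert.1 hj with rfl | hj'
            · exact (hij rfl).elim
            · exact (hxt j hj').2
            · exact fun h => (hxt i hi').2 (hr _ _ h)
            · exact htr i hi' j hj' hij

/-! ### Systems of bases, and the rounds that produce a necklace. -/

/-- A sequence of `r` bases with progress `w i` on the `i`-th one, pairwise clean with respect to
the set `A` that is still to be used. -/
structure BaseSystem {V : Type w} (G : SimpleGraph V) (ρ k : ℕ) (A : Set V) (r : ℕ)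
    (T L : ℕ → Set V) (h : ℕ → V → V) (B : ℕ → Set V) (p : ℕ → ℕ) : Prop where
  base : ∀ i < r, BaseOK G (T i) (L i) (h i) (B i)
  subset : ∀ i < r, A ⊆ B i
  progress : ∀ i < r, HasProgress G (h i) (B i) ρ k A (p i)
  hub_notMem : ∀ i < r, ∀ j < r, i ≠ j → ∀ z ∈ A, h i z ∉ T j ∪ L j
  hub_not_touch : ∀ i < r, ∀ j < r, i ≠ j → ∀ z ∈ A, ¬ Touch G (h i z) (T j ∪ L j)
  hub_ne : ∀ i < r, ∀ j < r, i ≠ j → ∀ z ∈ A, h i z ≠ h j z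
  anti : ∀ i < r, ∀ j < r, i ≠ j → Anti G (T i ∪ L i) (T j ∪ L j)

section Rounds

variable {V : Type w} {G : SimpleGraph V}

/-- Greedy choice: each chosen point removes a ball, which costs at most `τ` colours. -/
theorem exists_far_points {ρ τ : ℕ} (hτ : ∀ a, ColOn G {b | G.edist a b ≤ ρ} τ) (m : ℕ)
    {A : Set V} (hA : ¬ ColOn G A (m * τ)) :
    ∃ x : ℕ → V, (∀ i < m, x i ∈ A) ∧
      ∀ i < m, ∀ j < m, i ≠ j → (ρ : ℕ∞) < G.edist (x i) (x j) := by
  classical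
  induction m generalizing A with
  | zero =>
    obtain ⟨a, -⟩ := nonempty_of_not_colOn hA
    exact ⟨fun _ => a, by simp, by simp⟩
  | succ m ih =>
    rw [Nat.succ_mul] at hA
    obtain ⟨y, hy⟩ := nonempty_of_not_colOn hA
    obtain ⟨x, hx, hfar⟩ := ih (not_colOn_diff hA (hτ y))
    have hne : ∀ i, i < m → Function.update x m y i = x i := fun i hi =>
      Function.update_of_ne hi.ne ..
    have hself : Function.update x m y m = y := Function.update_self ..
    have hcases : ∀ i, i < m + 1 → i < m ∨ i = m := fun i hi => by omega
    refine ⟨Function.update x m y, fun i hi => ?_, fun i hi j hj hij => ?_⟩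
    · rcases hcases i hi with h | rfl
      · rw [hne i h]; exact (hx i h).1
      · rw [hself]; exact hy
    · rcases hcases i hi with h | rfl <;> rcases hcases j hj with h' | rfl
      · rw [hne i h, hne j h']; exact hfar i h j h' hij
      · rw [hne i h, hself, SimpleGraph.edist_comm]; exact not_le.1 (hx i h).2
      · rw [hne j h', hself]; exact not_le.1 (hx j h').2
      · exact (hij rfl).elim

theorem ColOn.of_fibres {ι : Type*} (P : Finset ι) {A : Set V} {M : ℕ} (f : V → ι)
    (hf : ∀ z ∈ A, f z ∈ P) (h : ∀ p ∈ P, ColOn G {z | z ∈ A ∧ f z = p} M) :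
    ColOn G A (P.card * M) := by
  classical
  suffices H : ∀ Q ⊆ P, ColOn G {z | z ∈ A ∧ f z ∈ Q} (Q.card * M) from
    (H P subset_rfl).mono (fun z hz => ⟨hz, hf z hz⟩) le_rfl
  intro Q
  induction Q using Finset.induction_on with
  | empty => exact fun _ => (ColOn.empty _).mono (by simp) le_rfl
  | insert p Q hp ih =>
    intro hQ
    rw [Finset.card_insert_of_notMem hp, Nat.succ_mul]
    refine ((ih ((Finset.subset_insert _ _).trans hQ)).union
      (h p (hQ (Finset.mem_insert_self _ _)))).mono ?_ le_rfl
    rintro z ⟨hz, hz'⟩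
    rcases Finset.mem_insert.1 hz' with h' | h'
    · exact Or.inr ⟨hz, h'⟩
    · exact Or.inl ⟨hz, h'⟩

/-- As the vertices `f i` are distinct, `κ + 1` pairwise related indices would give a clique that is
too large. -/
theorem exists_stable_hubs [Finite V] {κ s R : ℕ}
    (hR : ∀ (r : ℕ → ℕ → Prop), (∀ i j, r i j → r j i) →
      ∀ t : Finset ℕ, R ≤ t.card →
        (∃ t' ⊆ t, t'.card = κ + 1 ∧ ∀ i ∈ t', ∀ j ∈ t', i ≠ j → r i j) ∨
        (∃ t' ⊆ t, t'.card = s ∧ ∀ i ∈ t', ∀ j ∈ t', i ≠ j → ¬ r i j))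
    (hω : G.cliqueNum ≤ κ) (f : ℕ → V)
    (hf : ∀ i < R, ∀ j < R, i ≠ j → f i ≠ f j) :
    ∃ t ⊆ Finset.range R, t.card = s ∧ ∀ i ∈ t, ∀ j ∈ t, i ≠ j → ¬ G.Adj (f i) (f j) := by
  classical
  rcases hR (fun i j => G.Adj (f i) (f j)) (fun i j h => h.symm) (Finset.range R)
    (by simp) with ⟨t, ht, htc, htr⟩ | h
  · exfalso
    have hclique : G.IsClique (t.image f : Finset V) := by
      intro a ha b hb hab
      simp only [Finset.coe_image, Set.mem_image, Finset.mem_coe] at ha hb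
      obtain ⟨i, hi, rfl⟩ := ha
      obtain ⟨j, hj, rfl⟩ := hb
      exact htr i hi j hj (fun h => hab (by rw [h]))
    have := hclique.card_le_cliqueNum
    rw [Finset.card_image_of_injOn] at this
    · omega
    · intro i hi j hj hij
      by_contra hne
      exact hf i (Finset.mem_range.1 (ht hi)) j (Finset.mem_range.1 (ht hj)) hne hij
  · exact h

theorem not_adj_of_lt_edist {a b : V} {D : ℕ} (hD : 1 ≤ D) (h : (D : ℕ∞) < G.edist a b) :
    a ≠ b ∧ ¬ G.Adj a b := by
  constructor
  · rintro rfl; simp at h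
  · intro hab
    rw [SimpleGraph.edist_eq_one_iff_adj.2 hab] at h
    have : (1 : ℕ∞) ≤ D := by exact_mod_cast hD
    exact absurd (h.trans_le this) (lt_irrefl _)

/-- Here the necklace consists of the far apart points `x i` themselves. A connecting set is the
whole `T ∪ L` of one base together with the hubs in that base of the two points to be joined. Sets
from different bases are anticomplete: hubs of one point by the Ramsey choice, hubs of different
points by distance, and the rest by cleanness of the system. -/
theorem BaseSystem.exists_necklace [Finite V] {ρ k m D κ τ R : ℕ} {A : Set V}
    {T L : ℕ → Set V} {h : ℕ → V → V} {B : ℕ → Set V} {p : ℕ → ℕ}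
    (hR : ∀ (r : ℕ → ℕ → Prop), (∀ i j, r i j → r j i) →
      ∀ t : Finset ℕ, R ≤ t.card →
        (∃ t' ⊆ t, t'.card = κ + 1 ∧ ∀ i ∈ t', ∀ j ∈ t', i ≠ j → r i j) ∨
        (∃ t' ⊆ t, t'.card = m * k ∧ ∀ i ∈ t', ∀ j ∈ t', i ≠ j → ¬ r i j))
    (hω : G.cliqueNum ≤ κ) (hτ : ∀ a, ColOn G {b | G.edist a b ≤ ρ} τ)
    (hk : 0 < k) (hD : 2 ≤ D) (hρ : D + 2 ≤ ρ)
    (H : BaseSystem G ρ k A R T L h B p)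
    (hA : ¬ ColOn G A ((Finset.range R).powerset.card * (m * τ))) :
    ∃ v S, Necklace G m k D v S := by
  classical
  have hst : ∀ z, ∃ t : Finset ℕ, z ∈ A → t ⊆ Finset.range R ∧ t.card = m * k ∧
      ∀ i ∈ t, ∀ j ∈ t, i ≠ j → ¬ G.Adj (h i z) (h j z) := by
    intro z
    by_cases hz : z ∈ A
    · obtain ⟨t, ht⟩ := exists_stable_hubs hR hω (fun i => h i z)
        (fun i hi j hj hij => H.hub_ne i hi j hj hij z hz)
      exact ⟨t, fun _ => ht⟩
    · exact ⟨∅, fun h => (hz h).elim⟩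
  choose t ht using hst
  have hbig : ∃ I ∈ (Finset.range R).powerset, ¬ ColOn G {z | z ∈ A ∧ t z = I} (m * τ) := by
    by_contra hcon
    push Not at hcon
    exact hA (ColOn.of_fibres _ t (fun z hz => Finset.mem_powerset.2 (ht z hz).1) hcon)
  obtain ⟨I, -, hI⟩ := hbig
  obtain ⟨a, haA, haI⟩ := nonempty_of_not_colOn hI
  have hIR : I ⊆ Finset.range R := haI ▸ (ht a haA).1
  have hIc : I.card = m * k := haI ▸ (ht a haA).2.1
  have hIst : ∀ z ∈ A, t z = I → ∀ i ∈ I, ∀ j ∈ I, i ≠ j → ¬ G.Adj (h i z) (h j z) := by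
    intro z hz hzI
    have := (ht z hz).2.2
    rwa [hzI] at this
  obtain ⟨x, hx, hfar⟩ := exists_far_points hτ m hI
  have hfilter : (Finset.range R).filter (· ∈ I) = I := by
    ext i
    simp only [Finset.mem_filter, and_iff_right_iff_imp]
    exact fun hi => hIR hi
  obtain ⟨σ, hσ, hinj⟩ := exists_index_enumeration (K := R) (k := m * k) (p := (· ∈ I))
    (by rw [hfilter, hIc])
  have hvalid : ∀ i j, ValidLink m k i j → i < m ∧ (i + 1) % m < m ∧ j < k ∧ i * k + j < m * k := by
    intro i j hij
    have h1 : i < m ∧ j < k := by rcases hij with h | h <;> omega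
    refine ⟨h1.1, Nat.mod_lt _ (by omega), h1.2, ?_⟩
    calc i * k + j < (i + 1) * k := by rw [Nat.succ_mul]; omega
      _ ≤ m * k := by gcongr; omega
  have hxA : ∀ i < m, x i ∈ A := fun i hi => (hx i hi).1
  -- Writing a number below `m * k` as `i * k + j` gives every pair its own base.
  let b : ℕ → ℕ → ℕ := fun i j => σ (i * k + j)
  have hb : ∀ i j, ValidLink m k i j → b i j < R ∧ b i j ∈ I := fun i j hij =>
    hσ _ (hvalid i j hij).2.2.2
  have hbB : ∀ i j, ValidLink m k i j → ∀ l < m, x l ∈ B (b i j) := fun i j hij l hl =>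
    H.subset _ (hb i j hij).1 (hxA l hl)
  have hbne : ∀ i j i' j', ValidLink m k i j → ValidLink m k i' j' → (i ≠ i' ∨ j ≠ j') →
      b i j ≠ b i' j' := by
    intro i j i' j' hij hij' hne he
    obtain ⟨-, -, hj, h1⟩ := hvalid i j hij
    obtain ⟨-, -, hj', h2⟩ := hvalid i' j' hij'
    have heq := hinj _ h1 _ h2 he
    have e1 : (i * k + j) / k = i := by
      rw [add_comm, Nat.add_mul_div_right _ _ hk, Nat.div_eq_of_lt hj, zero_add]
    have e2 : (i' * k + j') / k = i' := by
      rw [add_comm, Nat.add_mul_div_right _ _ hk, Nat.div_eq_of_lt hj', zero_add]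
    have e3 : i = i' := by rw [← e1, heq, e2]
    subst e3
    omega
  have hfar2 : ∀ i j i' j' l l', ValidLink m k i j → ValidLink m k i' j' → l < m → l' < m →
      l ≠ l' → h (b i j) (x l) ≠ h (b i' j') (x l') ∧
        ¬ G.Adj (h (b i j) (x l)) (h (b i' j') (x l')) := by
    intro i j i' j' l l' hij hij' hl hl' hne
    refine not_adj_of_lt_edist (D := D) (by omega) (lt_edist_of_adj
      (lt_of_le_of_lt ?_ (hfar l hl l' hl' hne))
      ((H.base _ (hb i j hij).1).adj _ (hbB i j hij l hl))
      ((H.base _ (hb i' j' hij').1).adj _ (hbB i' j' hij' l' hl')))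
    exact_mod_cast hρ
  let S : ℕ → ℕ → Set V := fun i j => insert (h (b i j) (x i))
    (insert (h (b i j) (x ((i + 1) % m))) (T (b i j) ∪ L (b i j)))
  have hmemS : ∀ i j, ValidLink m k i j → ∀ a ∈ S i j,
      (∃ l < m, (l = i ∨ l = (i + 1) % m) ∧ a = h (b i j) (x l)) ∨ a ∈ T (b i j) ∪ L (b i j) := by
    rintro i j hij a (rfl | rfl | ha)
    · exact Or.inl ⟨i, (hvalid i j hij).1, Or.inl rfl, rfl⟩
    · exact Or.inl ⟨_, (hvalid i j hij).2.1, Or.inr rfl, rfl⟩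
    · exact Or.inr ha
  refine ⟨x, S, ?_⟩
  constructor
  · intro i j hij
    have hB := H.base _ (hb i j hij).1
    obtain ⟨hi, hi', -⟩ := hvalid i j hij
    refine (hB.connU.insert_vertex ?_).insert_vertex ?_
    · exact (hB.touch_L _ (hbB i j hij _ hi')).mono Set.subset_union_right
    · exact (hB.touch_L _ (hbB i j hij _ hi)).mono
        (Set.subset_union_right.trans (Set.subset_insert _ _))
  · intro i j hij
    exact ⟨_, Or.inl rfl, (H.base _ (hb i j hij).1).adj _ (hbB i j hij _ (hvalid i j hij).1)⟩
  · intro i j hij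
    exact ⟨_, Or.inr (Or.inl rfl),
      (H.base _ (hb i j hij).1).adj _ (hbB i j hij _ (hvalid i j hij).2.1)⟩
  · rintro i j hij l hl hli hli' ⟨a, ha, hla⟩
    have hB := H.base _ (hb i j hij).1
    rcases hmemS i j hij a ha with ⟨l', hl', hl'', rfl⟩ | ha'
    · have hne : l ≠ l' := by rcases hl'' with rfl | rfl <;> assumption
      have h1 := hfar l hl l' hl' hne
      have h2 : G.edist (x l) (x l') ≤ 1 + 1 := by
        refine (G.edist_triangle (v := h (b i j) (x l'))).trans ?_
        rw [SimpleGraph.edist_eq_one_iff_adj.2 hla,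
          SimpleGraph.edist_eq_one_iff_adj.2 (hB.adj _ (hbB i j hij l' hl')).symm]
      have h3 : (2 : ℕ) ≤ ρ := by omega
      exact absurd (h1.trans_le (h2.trans (by norm_num; exact h3))) (lt_irrefl _)
    · exact (hB.anti _ (hbB i j hij l hl) a ha').2 hla
  · intro i j hij l hl ha
    have hB := H.base _ (hb i j hij).1
    rcases hmemS i j hij _ ha with ⟨l', hl', -, he⟩ | ha'
    · exact hB.hub_notMem _ (hbB i j hij l' hl') (he ▸ hbB i j hij l hl)
    · exact (hB.anti _ (hbB i j hij l hl) _ ha').1 rfl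
  · intro i j i' j' hij hij' hne a ha a' ha'
    have hbb := hbne i j i' j' hij hij' hne
    obtain ⟨hbR, hbI⟩ := hb i j hij
    obtain ⟨hbR', hbI'⟩ := hb i' j' hij'
    rcases hmemS i j hij a ha with ⟨l, hl, -, rfl⟩ | hU
    · rcases hmemS i' j' hij' a' ha' with ⟨l', hl', -, rfl⟩ | hU'
      · by_cases hll : l = l'
        · subst hll
          exact ⟨H.hub_ne _ hbR _ hbR' hbb _ (hxA l hl),
            hIst _ (hxA l hl) (hx l hl).2 _ hbI _ hbI' hbb⟩
        · exact hfar2 i j i' j' l l' hij hij' hl hl' hll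
      · refine ⟨?_, fun hadj => H.hub_not_touch _ hbR _ hbR' hbb _ (hxA l hl) ⟨a', hU', hadj⟩⟩
        rintro rfl
        exact H.hub_notMem _ hbR _ hbR' hbb _ (hxA l hl) hU'
    · rcases hmemS i' j' hij' a' ha' with ⟨l', hl', -, rfl⟩ | hU'
      · refine ⟨?_, fun hadj =>
          H.hub_not_touch _ hbR' _ hbR hbb.symm _ (hxA l' hl') ⟨a, hU, hadj.symm⟩⟩
        rintro rfl
        exact H.hub_notMem _ hbR' _ hbR hbb.symm _ (hxA l' hl') hU
      · exact H.anti _ hbR _ hbR' hbb a hU a' hU'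
  · intro l hl l' hl' hne
    refine lt_of_le_of_lt ?_ (hfar l hl l' hl' hne)
    exact_mod_cast (by omega : D ≤ ρ)

theorem BaseSystem.restrict {ρ k r r' : ℕ} {A : Set V} {T L : ℕ → Set V} {h : ℕ → V → V}
    {B : ℕ → Set V} {p : ℕ → ℕ} (H : BaseSystem G ρ k A r T L h B p) (hr : r' ≤ r) :
    BaseSystem G ρ k A r' T L h B p where
  base i hi := H.base i (by omega)
  subset i hi := H.subset i (by omega)
  progress i hi := H.progress i (by omega)
  hub_notMem i hi j hj := H.hub_notMem i (by omega) j (by omega)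
  hub_not_touch i hi j hj := H.hub_not_touch i (by omega) j (by omega)
  hub_ne i hi j hj := H.hub_ne i (by omega) j (by omega)
  anti i hi j hj := H.anti i (by omega) j (by omega)

theorem BaseSystem.mono {ρ k r : ℕ} {A A' : Set V} {T L : ℕ → Set V} {h : ℕ → V → V}
    {B : ℕ → Set V} {p : ℕ → ℕ} (H : BaseSystem G ρ k A r T L h B p) (hA : A' ⊆ A) :
    BaseSystem G ρ k A' r T L h B p where
  base := H.base
  subset i hi := hA.trans (H.subset i hi)
  progress i hi := (H.progress i hi).mono hA
  hub_notMem i hi j hj hij z hz := H.hub_notMem i hi j hj hij z (hA hz)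
  hub_not_touch i hi j hj hij z hz := H.hub_not_touch i hi j hj hij z (hA hz)
  hub_ne i hi j hj hij z hz := H.hub_ne i hi j hj hij z (hA hz)
  anti := H.anti

/-- Everything new, hubs included, lies in `A` and hence in every `B i`, which is anticomplete to
the old bases and contains no hub of its own vertices. The one condition that this does not yield is
that old hubs miss the new base, so it is assumed. -/
theorem BaseSystem.snoc {ρ k r : ℕ} {A F U₁ U₂ : Set V} {T L : ℕ → Set V} {h : ℕ → V → V}
    {B : ℕ → Set V} {p : ℕ → ℕ} {g : V → V} (H : BaseSystem G ρ k A r T L h B p)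
    (h1 : U₁ ⊆ A) (h2 : U₂ ⊆ A) (hF : F ⊆ A) (hg : ∀ z ∈ F, g z ∈ A)
    (hb : BaseOK G U₁ U₂ g F) (hnt : ∀ i < r, ∀ z ∈ F, ¬ Touch G (h i z) (U₁ ∪ U₂)) :
    BaseSystem G ρ k F (r + 1) (Function.update T r U₁) (Function.update L r U₂)
      (Function.update h r g) (Function.update B r F) (Function.update p r 0) := by
  have H' := H.mono hF
  have hU : U₁ ∪ U₂ ⊆ A := Set.union_subset h1 h2
  have hcases : ∀ i, i < r + 1 → i < r ∨ i = r := fun i hi => by omega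
  constructor
  · intro i hi
    rcases hcases i hi with h' | rfl
    · simp only [Function.update_of_ne h'.ne]; exact H.base i h'
    · simp only [Function.update_self]; exact hb
  · intro i hi
    rcases hcases i hi with h' | rfl
    · simp only [Function.update_of_ne h'.ne]; exact H'.subset i h'
    · simp only [Function.update_self]; exact subset_rfl
  · intro i hi
    rcases hcases i hi with h' | rfl
    · simp only [Function.update_of_ne h'.ne]; exact H'.progress i h'
    · simp only [Function.update_self]
      obtain ⟨a, -⟩ := hb.connT.1
      refine ⟨fun _ => a, fun _ => ∅, fun _ _ => 0, fun _ _ => ∅, ?_⟩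
      rw [Nat.zero_div]
      exact Progress.zero ρ k subset_rfl _
  · intro i hi j hj hij z hz
    rcases hcases i hi with h' | rfl <;> rcases hcases j hj with h'' | rfl
    · simp only [Function.update_of_ne h'.ne, Function.update_of_ne h''.ne]
      exact H'.hub_notMem i h' j h'' hij z hz
    · simp only [Function.update_of_ne h'.ne, Function.update_self]
      exact fun hm => (H.base i h').hub_notMem z (H'.subset i h' hz) (H.subset i h' (hU hm))
    · simp only [Function.update_of_ne h''.ne, Function.update_self]
      exact fun hm => ((H.base j h'').anti _ (H.subset j h'' (hg z hz)) _ hm).1 rfl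
    · exact (hij rfl).elim
  · intro i hi j hj hij z hz
    rcases hcases i hi with h' | rfl <;> rcases hcases j hj with h'' | rfl
    · simp only [Function.update_of_ne h'.ne, Function.update_of_ne h''.ne]
      exact H'.hub_not_touch i h' j h'' hij z hz
    · simp only [Function.update_of_ne h'.ne, Function.update_self]
      exact hnt i h' z hz
    · simp only [Function.update_of_ne h''.ne, Function.update_self]
      rintro ⟨a, ha, hza⟩
      exact ((H.base j h'').anti _ (H.subset j h'' (hg z hz)) _ ha).2 hza
    · exact (hij rfl).elim
  · intro i hi j hj hij z hz
    rcases hcases i hi with h' | rfl <;> rcases hcases j hj with h'' | rfl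
    · simp only [Function.update_of_ne h'.ne, Function.update_of_ne h''.ne]
      exact H'.hub_ne i h' j h'' hij z hz
    · simp only [Function.update_of_ne h'.ne, Function.update_self]
      exact fun he => (H.base i h').hub_notMem z (H'.subset i h' hz)
        (he ▸ H.subset i h' (hg z hz))
    · simp only [Function.update_of_ne h''.ne, Function.update_self]
      exact fun he => (H.base j h'').hub_notMem z (H'.subset j h'' hz)
        (he ▸ H.subset j h'' (hg z hz))
    · exact (hij rfl).elim
  · intro i hi j hj hij
    rcases hcases i hi with h' | rfl <;> rcases hcases j hj with h'' | rfl
    · simp only [Function.update_of_ne h'.ne, Function.update_of_ne h''.ne]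
      exact H.anti i h' j h'' hij
    · simp only [Function.update_of_ne h'.ne, Function.update_self]
      exact ((H.base i h').anti.mono (hU.trans (H.subset i h')) subset_rfl).symm
    · simp only [Function.update_of_ne h''.ne, Function.update_self]
      exact (H.base j h'').anti.mono (hU.trans (H.subset j h'')) subset_rfl
    · exact (hij rfl).elim

/-- A further round either makes progress on one of the bases or finds a new base. -/
theorem BaseSystem.step [Finite V] {ρ k r R N τ : ℕ} {A : Set V} {T L : ℕ → Set V}
    {h : ℕ → V → V} {B : ℕ → Set V} {p : ℕ → ℕ} (hρ : 2 ≤ ρ)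
    (hτ : ∀ a, ColOn G {b | G.edist a b ≤ ρ} τ) (H : BaseSystem G ρ k A r T L h B p) (hr : r ≤ R)
    (hA : ¬ ColOn G A (2 * (N + R * splitBound τ (2 * k) (N + τ)) + τ)) :
    ∃ (A' : Set V) (r' : ℕ) (T' L' : ℕ → Set V) (h' : ℕ → V → V) (B' : ℕ → Set V) (p' : ℕ → ℕ),
      ¬ ColOn G A' N ∧ BaseSystem G ρ k A' r' T' L' h' B' p' ∧
      r + ∑ i ∈ Finset.range r, p i < r' + ∑ i ∈ Finset.range r', p' i := by
  classical
  have hρ' : (2 : ℕ∞) ≤ ρ := by exact_mod_cast hρ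
  obtain ⟨U₁, U₂, F, g, h1, h2, hF, hg, hFN, hb⟩ := exists_base
    (fun a => (hτ a).mono (fun b hb => le_trans hb hρ') le_rfl) hA
  -- If some `Z i` has large chromatic number, `U₁ ∪ U₂` is a new route on base `i`. Otherwise
  -- deleting all of them makes the new base clean.
  let Z : ℕ → Set V := fun i => {z | z ∈ F ∧ Touch G (h i z) (U₁ ∪ U₂)}
  by_cases hcase : ∃ i < r, ¬ ColOn G (Z i) (splitBound τ (2 * k) (N + τ))
  · obtain ⟨i, hi, hZ⟩ := hcase
    have hZF : Z i ⊆ F := fun z hz => hz.1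
    obtain ⟨A', hA', hN, hprog⟩ := (H.progress i hi).succ hρ hτ (H.base i hi).adj (hZF.trans hF)
      (Set.union_subset h1 h2) hb.connU (hb.anti.mono hZF subset_rfl).symm (fun z hz => hz.2) hZ
    have hA'A : A' ⊆ A := hA'.trans (hZF.trans hF)
    refine ⟨A', r, T, L, h, B, Function.update p i (p i + 1), hN,
      { H.mono hA'A with progress := fun j hj => ?_ }, ?_⟩
    · by_cases hji : j = i
      · subst hji; rw [Function.update_self]; exact hprog
      · rw [Function.update_of_ne hji]; exact (H.mono hA'A).progress j hj
    · have : ∑ j ∈ Finset.range r, p j < ∑ j ∈ Finset.range r, Function.update p i (p i + 1) j := by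
        refine Finset.sum_lt_sum (fun j _ => ?_) ⟨i, Finset.mem_range.2 hi, by simp⟩
        by_cases hji : j = i
        · subst hji; simp
        · rw [Function.update_of_ne hji]
      omega
  · push Not at hcase
    have hsmall := ColOn.biUnion r hcase
    have hsub : F \ {a | ∃ i < r, a ∈ Z i} ⊆ F := Set.sdiff_subset
    have hbig : ¬ ColOn G (F \ {a | ∃ i < r, a ∈ Z i}) N :=
      not_colOn_diff (fun hc => hFN (hc.mono subset_rfl (by gcongr))) hsmall
    refine ⟨_, r + 1, _, _, _, _, _, hbig, H.snoc h1 h2 (hsub.trans hF)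
      (fun z hz => hg z (hsub hz)) (hb.mono hsub)
      (fun i hi z hz ht => hz.2 ⟨i, hi, hz.1, ht⟩), ?_⟩
    rw [Finset.sum_range_succ, Function.update_self]
    have : ∑ j ∈ Finset.range r, Function.update p r 0 j = ∑ j ∈ Finset.range r, p j :=
      Finset.sum_congr rfl fun j hj => Function.update_of_ne (Finset.mem_range.1 hj).ne ..
    omega

/-- The chromatic number that suffices for `s` further rounds. -/
def roundBound (τ k R N : ℕ) : ℕ → ℕ
  | 0 => N
  -- A round halves the number of colours in the search for a base, and then either removes up to
  -- `R` sets `Z i` or passes to one of them and possibly chooses a centre.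
  | s + 1 => 2 * (roundBound τ k R N s + R * splitBound τ (2 * k) (roundBound τ k R N s + τ)) + τ

theorem le_roundBound (τ k R N s : ℕ) : N ≤ roundBound τ k R N s := by
  induction s with
  | zero => exact le_rfl
  | succ s ih =>
    rw [roundBound]
    have := Nat.zero_le (R * splitBound τ (2 * k) (roundBound τ k R N s + τ))
    omega

/-- The number of bases plus the total number of routes grows in every round. Once it reaches `R + R
* (m * (2 * k))`, there are `R` bases or one base has `m * (2 * k)` routes. -/
theorem BaseSystem.exists_necklace_of_rounds [Finite V] {ρ k m D κ τ R : ℕ}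
    (hR : ∀ (r : ℕ → ℕ → Prop), (∀ i j, r i j → r j i) →
      ∀ t : Finset ℕ, R ≤ t.card →
        (∃ t' ⊆ t, t'.card = κ + 1 ∧ ∀ i ∈ t', ∀ j ∈ t', i ≠ j → r i j) ∨
        (∃ t' ⊆ t, t'.card = m * k ∧ ∀ i ∈ t', ∀ j ∈ t', i ≠ j → ¬ r i j))
    (hω : G.cliqueNum ≤ κ) (hτ : ∀ a, ColOn G {b | G.edist a b ≤ ρ} τ)
    (hm : 2 ≤ m) (hk : 0 < k) (hD : 2 ≤ D) (hρ : D + 2 ≤ ρ) (s : ℕ) :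
    ∀ {r : ℕ} {A : Set V} {T L : ℕ → Set V} {h : ℕ → V → V} {B : ℕ → Set V} {p : ℕ → ℕ},
      BaseSystem G ρ k A r T L h B p →
      ¬ ColOn G A (roundBound τ k R ((Finset.range R).powerset.card * (m * τ)) s) →
      R + R * (m * (2 * k)) ≤ r + ∑ i ∈ Finset.range r, p i + s →
      ∃ v S, Necklace G m k D v S := by
  induction s with
  | zero =>
    intro r A T L h B p H hA hs
    by_cases hrR : R ≤ r
    · exact (H.restrict hrR).exists_necklace hR hω hτ hk hD hρ hA
    · have : ∃ i ∈ Finset.range r, m * (2 * k) ≤ p i := by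
        by_contra hcon
        push Not at hcon
        have h1 : ∑ i ∈ Finset.range r, p i ≤ r * (m * (2 * k)) := by
          simpa using Finset.sum_le_sum fun i hi => (hcon i hi).le
        have h2 : r * (m * (2 * k)) ≤ R * (m * (2 * k)) := by gcongr; omega
        omega
      obtain ⟨i, hi, hp⟩ := this
      have hi := Finset.mem_range.1 hi
      exact exists_necklace_of_progress (H.base i hi) hm hk hD hρ (H.progress i hi) hp
  | succ s ih =>
    intro r A T L h B p H hA hs
    by_cases hrR : R ≤ r
    · exact (H.restrict hrR).exists_necklace hR hω hτ hk hD hρ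
        (fun hc => hA (hc.mono subset_rfl (le_roundBound ..)))
    · obtain ⟨A', r', T', L', h', B', p', hN, H', hlt⟩ := H.step (R := R) (by omega) hτ (by omega) hA
      exact ih H' hN (by omega)

end Rounds

/-- Graphs of bounded clique number and bounded local chromatic number either have bounded
chromatic number or contain a necklace. -/
theorem exists_bound_necklace (κ τ m k D ρ : ℕ) (hm : 2 ≤ m) (hk : 0 < k) (hD : 2 ≤ D)
    (hρ : D + 2 ≤ ρ) :
    ∃ c : ℕ, ∀ (V : Type w) [Finite V] (G : SimpleGraph V), G.cliqueNum ≤ κ →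
      (∀ a, ColOn G {b | G.edist a b ≤ ρ} τ) → ¬ ColOn G Set.univ c →
      ∃ v S, Necklace G m k D v S := by
  obtain ⟨R, hR⟩ := exists_ramsey (κ + 1) (m * k)
  refine ⟨roundBound τ k R ((Finset.range R).powerset.card * (m * τ)) (R + R * (m * (2 * k))),
    fun V _ G hω hτ hc => ?_⟩
  refine BaseSystem.exists_necklace_of_rounds (r := 0) (A := Set.univ) (T := fun _ => ∅)
    (L := fun _ => ∅) (h := fun _ a => a) (B := fun _ => ∅) (p := fun _ => 0) hR hω hτ hm hk hD hρ
    (R + R * (m * (2 * k))) ?_ hc (by simp)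
  constructor <;> simp

/-! ### Strands, and chordless paths through connected sets. -/

/-- The graph `J` is made of internally disjoint paths `q s 0, …, q s (ℓ s)`, called strands, each
of which joins two consecutive ones of the cyclically arranged vertices `c 0, …, c (m - 1)`. -/
structure StrandSystem {W : Type w} {ι : Type u} (J : SimpleGraph W) (m : ℕ) (pos : ι → ℕ)
    (c : ℕ → W) (ℓ : ι → ℕ) (q : ι → ℕ → W) : Prop where
  pos_lt : ∀ s, pos s < m
  inj_centre : ∀ i < m, ∀ j < m, c i = c j → i = j
  start : ∀ s, q s 0 = c (pos s)
  finish : ∀ s, q s (ℓ s) = c ((pos s + 1) % m)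
  length_pos : ∀ s, 0 < ℓ s
  inj : ∀ s, ∀ t ≤ ℓ s, ∀ t' ≤ ℓ s, q s t = q s t' → t = t'
  adj : ∀ s, ∀ t < ℓ s, J.Adj (q s t) (q s (t + 1))
  ends : ∀ s s', s ≠ s' → ∀ t ≤ ℓ s, ∀ t' ≤ ℓ s', q s t = q s' t' → t = 0 ∨ t = ℓ s
  centre : ∀ s, ∀ t ≤ ℓ s, ∀ i < m, q s t = c i → t = 0 ∨ t = ℓ s
  edges : ∀ s s', s ≠ s' → ∀ t < ℓ s, ∀ t' < ℓ s',
    s(q s t, q s (t + 1)) ≠ s(q s' t', q s' (t' + 1))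
  cover_verts : ∀ x, (∃ i < m, x = c i) ∨ ∃ s, ∃ t ≤ ℓ s, x = q s t
  cover_adj : ∀ x y, J.Adj x y → ∃ s, ∃ t < ℓ s, s(x, y) = s(q s t, q s (t + 1))

section Segments

variable {V : Type w} {G : SimpleGraph V}

/-- The part of a sequence of consecutively adjacent vertices between two of its members. -/
def seqSubgraph (G : SimpleGraph V) (f : ℕ → V) (t t' : ℕ) : G.Subgraph where
  verts := {x | ∃ r, t ≤ r ∧ r ≤ t' ∧ x = f r}
  Adj x y := G.Adj x y ∧ ∃ r, t ≤ r ∧ r < t' ∧ s(x, y) = s(f r, f (r + 1))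
  adj_sub h := h.1
  edge_vert := by
    rintro x y ⟨-, r, h1, h2, h3⟩
    rcases Sym2.eq_iff.1 h3 with ⟨h, -⟩ | ⟨h, -⟩
    · exact ⟨r, h1, h2.le, h⟩
    · exact ⟨r + 1, by omega, h2, h⟩
  symm := ⟨by
    rintro x y ⟨h0, r, h1, h2, h3⟩
    exact ⟨h0.symm, r, h1, h2, by rw [Sym2.eq_swap, h3]⟩⟩

theorem exists_walk_of_seq (f : ℕ → V) (t d : ℕ)
    (hadj : ∀ r, t ≤ r → r < t + d → G.Adj (f r) (f (r + 1)))
    (hinj : ∀ r, t ≤ r → r ≤ t + d → ∀ r', t ≤ r' → r' ≤ t + d → f r = f r' → r = r') :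
    ∃ p : G.Walk (f t) (f (t + d)), p.IsPath ∧ p.length = d ∧
      (∀ x, x ∈ p.support ↔ ∃ r, t ≤ r ∧ r ≤ t + d ∧ x = f r) ∧
      ∀ e, e ∈ p.edges ↔ ∃ r, t ≤ r ∧ r < t + d ∧ e = s(f r, f (r + 1)) := by
  induction d with
  | zero =>
    refine ⟨.nil, by simp, by simp, fun x => ?_, fun e => ?_⟩
    · simp only [add_zero, SimpleGraph.Walk.support_nil, List.mem_singleton]
      constructor
      · rintro rfl; exact ⟨t, le_rfl, le_rfl, rfl⟩
      · rintro ⟨r, h1, h2, rfl⟩; rw [le_antisymm h2 h1]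
    · simp only [add_zero, SimpleGraph.Walk.edges_nil, List.not_mem_nil, false_iff]
      rintro ⟨r, h1, h2, -⟩
      omega
  | succ d ih =>
    obtain ⟨p, hp, hl, hs, he⟩ := ih (fun r h1 h2 => hadj r h1 (by omega))
      (fun r h1 h2 r' h1' h2' => hinj r h1 (by omega) r' h1' (by omega))
    have ha := hadj (t + d) (by omega) (by omega)
    refine ⟨p.concat ha, ?_, by simp [hl], fun x => ?_, fun e => ?_⟩
    · rw [SimpleGraph.Walk.isPath_def, SimpleGraph.Walk.support_concat,
        ← List.concat_eq_append, List.nodup_concat]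
      refine ⟨fun hmem => ?_, hp.support_nodup⟩
      obtain ⟨r, h1, h2, h3⟩ := (hs _).1 hmem
      have := hinj (t + d + 1) (by omega) (by omega) r h1 (by omega) h3
      omega
    · simp only [SimpleGraph.Walk.support_concat, List.mem_append,
        List.mem_singleton, hs]
      constructor
      · rintro (⟨r, h1, h2, h3⟩ | h)
        · exact ⟨r, h1, by omega, h3⟩
        · exact ⟨t + d + 1, by omega, le_rfl, h⟩
      · rintro ⟨r, h1, h2, h3⟩
        by_cases h : r ≤ t + d
        · exact Or.inl ⟨r, h1, h, h3⟩
        · obtain rfl : r = t + d + 1 := by omega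
          exact Or.inr h3
    · simp only [SimpleGraph.Walk.edges_concat, List.concat_eq_append, List.mem_append,
        List.mem_singleton, he]
      constructor
      · rintro (⟨r, h1, h2, h3⟩ | h)
        · exact ⟨r, h1, by omega, h3⟩
        · exact ⟨t + d, by omega, by omega, h⟩
      · rintro ⟨r, h1, h2, h3⟩
        by_cases h : r < t + d
        · exact Or.inl ⟨r, h1, h, h3⟩
        · obtain rfl : r = t + d := by omega
          exact Or.inr h3

theorem isPathSubgraph_seqSubgraph {f : ℕ → V} {t t' : ℕ} (htt : t < t')
    (hadj : ∀ r, t ≤ r → r < t' → G.Adj (f r) (f (r + 1)))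
    (hinj : ∀ r, t ≤ r → r ≤ t' → ∀ r', t ≤ r' → r' ≤ t' → f r = f r' → r = r') :
    IsPathSubgraph (seqSubgraph G f t t') (f t) (f t') := by
  obtain ⟨d, rfl⟩ := Nat.exists_eq_add_of_le htt.le
  obtain ⟨p, hp, hl, hs, he⟩ := exists_walk_of_seq f t d hadj hinj
  refine ⟨p, hp, by omega, SimpleGraph.Subgraph.ext ?_ ?_⟩
  · ext x
    rw [SimpleGraph.Walk.mem_verts_toSubgraph, hs]
    exact Iff.rfl
  · ext x y
    rw [SimpleGraph.Walk.adj_toSubgraph_iff_mem_edges, he]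
    refine ⟨fun h => h.2, ?_⟩
    rintro ⟨r, h1, h2, h3⟩
    refine ⟨?_, r, h1, h2, h3⟩
    rw [← SimpleGraph.mem_edgeSet, h3]
    exact hadj r h1 h2

theorem IsPathSubgraph.symm {P : G.Subgraph} {s t : V} (h : IsPathSubgraph P s t) :
    IsPathSubgraph P t s := by
  obtain ⟨p, hp, hl, rfl⟩ := h
  exact ⟨p.reverse, hp.reverse, by simpa using hl, p.toSubgraph_reverse.symm⟩

/-- Two vertices attached to a connected set `S` are joined by a chordless path through `S`. -/
theorem exists_chordless_path {S : Set V} {a b : V} {D : ℕ} (hS : ConnOn G S) (ha : Touch G a S)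
    (hb : Touch G b S) (hab : (D : ℕ∞) < G.edist a b) :
    ∃ (d : ℕ) (f : ℕ → V), D < d ∧ f 0 = a ∧ f d = b ∧
      (∀ t, 0 < t → t < d → f t ∈ S) ∧ (∀ t ≤ d, ∀ t' ≤ d, f t = f t' → t = t') ∧
      (∀ t < d, G.Adj (f t) (f (t + 1))) ∧
      ∀ t ≤ d, ∀ t' ≤ d, G.Adj (f t) (f t') → t' = t + 1 ∨ t = t' + 1 := by
  have hA : ConnOn G (insert a (insert b S)) :=
    (hS.insert_vertex hb).insert_vertex (ha.mono (Set.subset_insert _ _))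
  -- The path descends one level at a time from `a` to `b`. Adjacent vertices differ by at most one
  -- level, so it has no chords.
  obtain ⟨lev, h0, h0', hadj, hpred⟩ := hA.exists_levels (r := b) (Or.inr (Or.inl rfl))
  have hex : ∀ z, ∃ y, z ∈ insert a (insert b S) → lev z ≠ 0 →
      y ∈ insert a (insert b S) ∧ G.Adj z y ∧ lev y + 1 = lev z := by
    intro z
    by_cases hz : z ∈ insert a (insert b S) ∧ lev z ≠ 0
    · obtain ⟨n, hn⟩ := Nat.exists_eq_succ_of_ne_zero hz.2
      obtain ⟨y, h1, h2, h3⟩ := hpred z hz.1 n hn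
      exact ⟨y, fun _ _ => ⟨h1, h2, by omega⟩⟩
    · exact ⟨z, fun h h' => (hz ⟨h, h'⟩).elim⟩
  choose g hg using hex
  have hmem : ∀ t ≤ lev a, g^[t] a ∈ insert a (insert b S) ∧ lev (g^[t] a) + t = lev a := by
    intro t
    induction t with
    | zero => exact fun _ => ⟨Or.inl rfl, rfl⟩
    | succ t ih =>
      intro ht
      obtain ⟨h1, h2⟩ := ih (by omega)
      obtain ⟨h3, -, h4⟩ := hg _ h1 (by omega)
      rw [Function.iterate_succ_apply']
      exact ⟨h3, by omega⟩
  have hstep : ∀ t < lev a, G.Adj (g^[t] a) (g^[t + 1] a) := by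
    intro t ht
    obtain ⟨h1, h2⟩ := hmem t ht.le
    rw [Function.iterate_succ_apply']
    exact (hg _ h1 (by omega)).2.1
  have hlast : g^[lev a] a = b := by
    obtain ⟨h1, h2⟩ := hmem (lev a) le_rfl
    exact h0' _ h1 (by omega)
  have hdist : ∀ t ≤ lev a, G.edist a (g^[t] a) ≤ t := by
    intro t
    induction t with
    | zero => simp
    | succ t ih =>
      intro ht
      refine (G.edist_triangle (v := g^[t] a)).trans ?_
      push_cast
      exact add_le_add (ih (by omega))
        (le_of_eq (SimpleGraph.edist_eq_one_iff_adj.2 (hstep t ht)))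
  refine ⟨lev a, fun t => g^[t] a, ?_, rfl, hlast, ?_, ?_, hstep, ?_⟩
  · have := hdist (lev a) le_rfl
    rw [hlast] at this
    exact_mod_cast hab.trans_le this
  · intro t ht htd
    obtain ⟨h1, h2⟩ := hmem t htd.le
    rcases h1 with h | h | h
    · rw [h] at h2; omega
    · rw [h, h0] at h2; omega
    · exact h
  · intro t ht t' ht' he
    have h1 := (hmem t ht).2
    have h2 := (hmem t' ht').2
    simp only at he
    rw [he] at h1
    omega
  · intro t ht t' ht' he
    have h1 := hmem t ht
    have h2 := hmem t' ht'
    have h3 := hadj _ h1.1 _ h2.1 he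
    have h4 := hadj _ h2.1 _ h1.1 he.symm
    have h5 : t ≠ t' := by rintro rfl; exact G.loopless.irrefl _ he
    omega

end Segments

/-! ### Lengthening strands gives a subdivision. -/

section Subdivision

variable {W : Type u} {X : Type w} {ι : Type v} {J : SimpleGraph W} {H : SimpleGraph X} {m : ℕ}
  {pos : ι → ℕ} {c : ℕ → W} {ℓ : ι → ℕ} {q : ι → ℕ → W} {c' : ℕ → X} {L : ι → ℕ} {Q : ι → ℕ → X}

/-- Replacing the strands by longer ones gives a subdivision. -/
theorem StrandSystem.isSubdivisionOf (hJ : StrandSystem J m pos c ℓ q)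
    (hH : StrandSystem H m pos c' L Q) (hle : ∀ s, ℓ s ≤ L s) :
    IsSubdivisionOf H (Graph.ofSimpleGraph J) := by
  classical
  have hmod : ∀ s, (pos s + 1) % m < m := fun s => Nat.mod_lt _ (by have := hJ.pos_lt s; omega)
  -- All the extra length goes into the last edge of the strand.
  let ψ : ι → ℕ → ℕ := fun s t => if t = ℓ s then L s else t
  have hψL : ∀ s, ψ s (ℓ s) = L s := fun s => by simp [ψ]
  have hψ0 : ∀ s, ψ s 0 = 0 := fun s => by simp [ψ, (hJ.length_pos s).ne]
  have hψt : ∀ s t, t < ℓ s → ψ s t = t := fun s t ht => by simp [ψ, ht.ne]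
  have hψle : ∀ s t, t ≤ ℓ s → ψ s t ≤ L s := by
    intro s t ht
    have := hle s
    by_cases h : t = ℓ s
    · rw [h, hψL]
    · rw [hψt s t (by omega)]; omega
  have hψlt : ∀ s t t', t < t' → t' ≤ ℓ s → ψ s t < ψ s t' := by
    intro s t t' h h'
    have := hle s
    rw [hψt s t (by omega)]
    by_cases h2 : t' = ℓ s
    · rw [h2, hψL]; omega
    · rw [hψt s t' (by omega)]; exact h
  have hψmono : ∀ s t t', t ≤ ℓ s → t' ≤ ℓ s → ψ s t ≤ ψ s t' → t ≤ t' := by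
    intro s t t' h h' h2
    by_contra h3
    have := hψlt s t' t (by omega) h
    omega
  -- A vertex can occur as a centre and on several strands. The prescriptions agree, because
  -- distinct strands meet only at their ends and these are centres.
  have hexφ : ∀ x, ∃ y, (∀ i < m, x = c i → y = c' i) ∧
      ∀ s, ∀ t ≤ ℓ s, x = q s t → y = Q s (ψ s t) := by
    intro x
    by_cases hx : ∃ i < m, x = c i
    · obtain ⟨i, hi, rfl⟩ := hx
      refine ⟨c' i, fun j hj h => by rw [hJ.inj_centre i hi j hj h], fun s t ht h => ?_⟩
      rcases hJ.centre s t ht i hi h.symm with rfl | rfl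
      · rw [hψ0, hH.start]
        rw [hJ.start] at h
        rw [hJ.inj_centre i hi _ (hJ.pos_lt s) h]
      · rw [hψL, hH.finish]
        rw [hJ.finish] at h
        rw [hJ.inj_centre i hi _ (hmod s) h]
    · obtain ⟨s, t, ht, rfl⟩ := (hJ.cover_verts x).resolve_left hx
      refine ⟨Q s (ψ s t), fun i hi h => (hx ⟨i, hi, h⟩).elim, fun s' t' ht' h => ?_⟩
      by_cases hss : s = s'
      · subst hss
        rw [hJ.inj s t ht t' ht' h]
      · exfalso
        rcases hJ.ends s s' hss t ht t' ht' h with rfl | rfl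
        · exact hx ⟨_, hJ.pos_lt s, hJ.start s⟩
        · exact hx ⟨_, hmod s, hJ.finish s⟩
  choose φ hφc hφq using hexφ
  have hφc' : ∀ i < m, φ (c i) = c' i := fun i hi => hφc _ i hi rfl
  have hφq' : ∀ s, ∀ t ≤ ℓ s, φ (q s t) = Q s (ψ s t) := fun s t ht => hφq _ s t ht rfl
  have hcentre : ∀ i < m, ∀ s, ∀ r ≤ L s, c' i = Q s r →
      ∃ t ≤ ℓ s, c i = q s t ∧ ψ s t = r := by
    intro i hi s r hr h
    rcases hH.centre s r hr i hi h.symm with rfl | rfl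
    · rw [hH.start] at h
      rw [hH.inj_centre i hi _ (hJ.pos_lt s) h]
      exact ⟨0, by omega, (hJ.start s).symm, hψ0 s⟩
    · rw [hH.finish] at h
      rw [hH.inj_centre i hi _ (hmod s) h]
      exact ⟨ℓ s, le_rfl, (hJ.finish s).symm, hψL s⟩
  -- Conversely, only vertices of a strand of `J` are placed on the corresponding strand of `H`.
  have hpull : ∀ x s, ∀ r ≤ L s, φ x = Q s r → ∃ t ≤ ℓ s, x = q s t ∧ ψ s t = r := by
    intro x s r hr h
    rcases hJ.cover_verts x with ⟨i, hi, rfl⟩ | ⟨s', t', ht', rfl⟩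
    · exact hcentre i hi s r hr (hφc' i hi ▸ h)
    · rw [hφq' s' t' ht'] at h
      by_cases hss : s' = s
      · subst hss
        exact ⟨t', ht', rfl, hH.inj _ _ (hψle _ _ ht') r hr h⟩
      · rcases hH.ends s' s hss _ (hψle _ _ ht') r hr h with h' | h'
        · obtain rfl : t' = 0 := by
            have := hψmono s' t' 0 ht' (by omega) (by rw [h', hψ0])
            omega
          rw [hψ0, hH.start] at h
          rw [hJ.start]
          exact hcentre _ (hJ.pos_lt s') s r hr h
        · obtain rfl : t' = ℓ s' := by
            have := hψmono s' (ℓ s') t' le_rfl ht' (by rw [h', hψL])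
            omega
          rw [hψL, hH.finish] at h
          rw [hJ.finish]
          exact hcentre _ (hmod s') s r hr h
  have hexB : ∀ e, ∃ P : H.Subgraph, e ∈ J.edgeSet → ∃ s, ∃ t < ℓ s,
      e = s(q s t, q s (t + 1)) ∧ P = seqSubgraph H (Q s) (ψ s t) (ψ s (t + 1)) := by
    intro e
    by_cases he : e ∈ J.edgeSet
    · induction e with
      | _ x y =>
        obtain ⟨s, t, ht, h⟩ := hJ.cover_adj x y he
        exact ⟨_, fun _ => ⟨s, t, ht, h, rfl⟩⟩
    · exact ⟨⊥, fun h => (he h).elim⟩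
  choose B hB using hexB
  have hBq : ∀ s, ∀ t < ℓ s,
      B s(q s t, q s (t + 1)) = seqSubgraph H (Q s) (ψ s t) (ψ s (t + 1)) := by
    intro s t ht
    obtain ⟨s', t', ht', he, hP⟩ := hB s(q s t, q s (t + 1)) (hJ.adj s t ht)
    have hss : s = s' := by
      by_contra hss
      exact hJ.edges s s' hss t ht t' ht' he
    subst hss
    have htt : t = t' := by
      rcases Sym2.eq_iff.1 he with ⟨h, -⟩ | ⟨h, h'⟩
      · exact hJ.inj s t ht.le t' ht'.le h
      · have := hJ.inj s t ht.le (t' + 1) ht' h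
        have := hJ.inj s (t + 1) ht t' ht'.le h'
        omega
    rw [hP, htt]
  have hinc : ∀ e x, (Graph.ofSimpleGraph J).Inc e x ↔ e ∈ J.edgeSet ∧ x ∈ e := by
    intro e x
    constructor
    · rintro ⟨y, rfl, h⟩
      exact ⟨h, Sym2.mem_mk_left _ _⟩
    · rintro ⟨h, hx⟩
      obtain ⟨y, rfl⟩ := Sym2.mem_iff_exists.1 hx
      exact ⟨y, rfl, h⟩
  have hincB : ∀ e ∈ J.edgeSet, ∀ x, φ x ∈ (B e).verts → x ∈ e := by
    intro e he x hx
    obtain ⟨s, t, ht, rfl, hP⟩ := hB e he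
    rw [hP] at hx
    obtain ⟨r, h1, h2, h3⟩ := hx
    obtain ⟨t', ht', rfl, rfl⟩ := hpull x s r (h2.trans (hψle s _ ht)) h3
    have a1 := hψmono s t t' ht.le ht' h1
    have a2 := hψmono s t' (t + 1) ht' ht h2
    rcases (by omega : t' = t ∨ t' = t + 1) with rfl | rfl
    · exact Sym2.mem_mk_left _ _
    · exact Sym2.mem_mk_right _ _
  have hpath : ∀ s, ∀ t < ℓ s, IsPathSubgraph (seqSubgraph H (Q s) (ψ s t) (ψ s (t + 1)))
      (φ (q s t)) (φ (q s (t + 1))) := by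
    intro s t ht
    have := hψle s (t + 1) ht
    rw [hφq' s t ht.le, hφq' s (t + 1) ht]
    exact isPathSubgraph_seqSubgraph (hψlt s t (t + 1) (by omega) ht)
      (fun r _ h => hH.adj s r (by omega))
      (fun r _ h r' _ h' => hH.inj s r (by omega) r' (by omega))
  have hidx : ∀ s, ∀ r < L s, ∃ t < ℓ s, ψ s t ≤ r ∧ r < ψ s (t + 1) := by
    intro s r hr
    have := hJ.length_pos s
    by_cases h : r + 1 < ℓ s
    · exact ⟨r, by omega, by rw [hψt s r (by omega)], by rw [hψt s _ h]; omega⟩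
    · refine ⟨ℓ s - 1, by omega, ?_, ?_⟩
      · rw [hψt s _ (by omega)]; omega
      · rw [Nat.sub_add_cancel this, hψL]; exact hr
  refine ⟨φ, B, ?_⟩
  constructor
  · intro x _ y _ hxy
    rcases hJ.cover_verts x with ⟨i, hi, rfl⟩ | ⟨s, t, ht, rfl⟩
    · rcases hJ.cover_verts y with ⟨j, hj, rfl⟩ | ⟨s, t, ht, rfl⟩
      · rw [hφc' i hi, hφc' j hj] at hxy
        rw [hH.inj_centre i hi j hj hxy]
      · rw [hφq' s t ht] at hxy
        obtain ⟨t', ht', hx, hψ⟩ := hpull _ s _ (hψle s t ht) hxy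
        rw [hx, le_antisymm (hψmono s t' t ht' ht hψ.le) (hψmono s t t' ht ht' hψ.ge)]
    · rw [hφq' s t ht] at hxy
      obtain ⟨t', ht', hx, hψ⟩ := hpull _ s _ (hψle s t ht) hxy.symm
      rw [hx, le_antisymm (hψmono s t' t ht' ht hψ.le) (hψmono s t t' ht ht' hψ.ge)]
  · rintro e x y ⟨rfl, he⟩
    obtain ⟨s, t, ht, hxy, hP⟩ := hB _ he
    rw [hP]
    rcases Sym2.eq_iff.1 hxy with ⟨rfl, rfl⟩ | ⟨rfl, rfl⟩
    · exact hpath s t ht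
    · exact (hpath s t ht).symm
  · intro e he x _ hx
    exact (hinc e x).2 ⟨he, hincB e he x hx⟩
  · intro e he f hf hef a ha ha'
    suffices h : ∃ x, φ x = a by
      obtain ⟨x, rfl⟩ := h
      exact ⟨x, (hinc e x).2 ⟨he, hincB e he x ha⟩, (hinc f x).2 ⟨hf, hincB f hf x ha'⟩, rfl⟩
    obtain ⟨s, t, ht, rfl, hP⟩ := hB e he
    obtain ⟨s', t', ht', rfl, hP'⟩ := hB f hf
    rw [hP] at ha
    rw [hP'] at ha'
    obtain ⟨r, h1, h2, rfl⟩ := ha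
    obtain ⟨r', h1', h2', h3⟩ := ha'
    have hr := h2.trans (hψle s _ ht)
    have hr' := h2'.trans (hψle s' _ ht')
    by_cases hss : s = s'
    · subst hss
      obtain rfl := hH.inj s r hr r' hr' h3
      have a1 := hψmono s t (t' + 1) ht.le ht' (h1.trans h2')
      have a2 := hψmono s t' (t + 1) ht'.le ht (h1'.trans h2)
      have a3 : t ≠ t' := by rintro rfl; exact hef rfl
      rcases (by omega : t = t' + 1 ∨ t' = t + 1) with rfl | rfl
      · exact ⟨q s (t' + 1), by rw [hφq' s _ ht', le_antisymm h1 h2']⟩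
      · exact ⟨q s (t + 1), by rw [hφq' s _ ht, le_antisymm h1' h2]⟩
    · rcases hH.ends s s' hss r hr r' hr' h3 with rfl | rfl
      · exact ⟨q s 0, by rw [hφq' s 0 (by omega), hψ0]⟩
      · exact ⟨q s (ℓ s), by rw [hφq' s _ le_rfl, hψL]⟩
  · intro e he f hf hef
    obtain ⟨s, t, ht, rfl, hP⟩ := hB e he
    obtain ⟨s', t', ht', rfl, hP'⟩ := hB f hf
    rw [hP, hP', Set.disjoint_left]
    intro d hd hd'
    induction d with
    | _ x y =>
      obtain ⟨-, r, h1, h2, h3⟩ := hd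
      obtain ⟨-, r', h1', h2', h3'⟩ := hd'
      have hr := h2.trans_le (hψle s _ ht)
      have hr' := h2'.trans_le (hψle s' _ ht')
      have hss : s = s' := by
        by_contra hss
        exact hH.edges s s' hss r hr r' hr' (h3.symm.trans h3')
      subst hss
      have hrr : r = r' := by
        rcases Sym2.eq_iff.1 (h3.symm.trans h3') with ⟨h, -⟩ | ⟨h, h'⟩
        · exact hH.inj s r hr.le r' hr'.le h
        · have := hH.inj s r hr.le (r' + 1) hr' h
          have := hH.inj s (r + 1) hr r' hr'.le h'
          omega
      subst hrr
      have a3 : t ≠ t' := by rintro rfl; exact hef rfl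
      have a1 : t ≤ t' := by
        by_contra h
        rcases (by omega : t = t' + 1 ∨ t' + 1 < t) with rfl | h'
        · omega
        · have := hψlt s (t' + 1) t h' ht.le; omega
      have a2 : t' ≤ t := by
        by_contra h
        rcases (by omega : t' = t + 1 ∨ t + 1 < t') with rfl | h'
        · omega
        · have := hψlt s (t + 1) t' h' ht'.le; omega
      omega
  · intro a
    rcases hH.cover_verts a with ⟨i, hi, rfl⟩ | ⟨s, r, hr, rfl⟩
    · exact Or.inl ⟨c i, trivial, hφc' i hi⟩
    · rcases hr.lt_or_eq with h | rfl
      · obtain ⟨t, ht, h1, h2⟩ := hidx s r h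
        refine Or.inr ⟨s(q s t, q s (t + 1)), hJ.adj s t ht, ?_⟩
        rw [hBq s t ht]
        exact ⟨r, h1, h2.le, rfl⟩
      · exact Or.inl ⟨q s (ℓ s), trivial, by rw [hφq' s _ le_rfl, hψL]⟩
  · intro a b hab
    obtain ⟨s, r, hr, h⟩ := hH.cover_adj a b hab
    obtain ⟨t, ht, h1, h2⟩ := hidx s r hr
    refine ⟨s(q s t, q s (t + 1)), hJ.adj s t ht, ?_⟩
    rw [hBq s t ht]
    exact ⟨hab, r, h1, h2, h⟩

end Subdivision

/-! ### From a necklace to an induced subdivision. -/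

section FromNecklace

variable {V : Type w} {G : SimpleGraph V} {m k D : ℕ} {v : ℕ → V} {S : ℕ → ℕ → Set V}

/-- A necklace contains an induced subgraph made of long strands. -/
theorem Necklace.exists_strandSystem {ι : Type u} (H : Necklace G m k D v S) (hD : 2 ≤ D)
    (hm : 2 ≤ m) (pos j : ι → ℕ) (hpos : ∀ s, pos s < m)
    (hvalid : ∀ s, ValidLink m k (pos s) (j s))
    (hinj : ∀ s s', pos s = pos s' → j s = j s' → s = s') :
    ∃ (X : Set V) (c : ℕ → X) (L : ι → ℕ) (Q : ι → ℕ → X), (∀ s, D < L s) ∧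
      StrandSystem (G.induce X) m pos c L Q := by
  classical
  have hmod : ∀ s, (pos s + 1) % m < m := fun s => Nat.mod_lt _ (by omega)
  have hmodne : ∀ s, pos s ≠ (pos s + 1) % m := by
    intro s h
    have := hpos s
    rcases (by omega : pos s + 1 < m ∨ pos s + 1 = m) with h' | h'
    · rw [Nat.mod_eq_of_lt h'] at h; omega
    · rw [h', Nat.mod_self] at h; omega
  have hpath := fun s => exists_chordless_path (H.conn _ _ (hvalid s)) (H.touch_left _ _ (hvalid s))
    (H.touch_right _ _ (hvalid s)) (H.far _ (hpos s) _ (hmod s) (hmodne s))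
  choose L f hDL hf0 hfL hfS hfinj hfadj hfch using hpath
  let X : Set V := {x | (∃ i < m, x = v i) ∨ ∃ s t, 0 < t ∧ t < L s ∧ x = f s t}
  have hfX : ∀ s, ∀ t ≤ L s, f s t ∈ X := by
    intro s t ht
    by_cases h0 : t = 0
    · exact Or.inl ⟨_, hpos s, h0 ▸ hf0 s⟩
    by_cases hL : t = L s
    · exact Or.inl ⟨_, hmod s, hL ▸ hfL s⟩
    exact Or.inr ⟨s, t, by omega, by omega, rfl⟩
  have hvX : ∀ i, v (i % m) ∈ X := fun i => Or.inl ⟨_, Nat.mod_lt _ (by omega), rfl⟩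
  have hint : ∀ s t, 0 < t → t < L s → ∀ i < m, f s t ≠ v i := by
    intro s t h1 h2 i hi he
    exact H.notMem _ _ (hvalid s) i hi (he ▸ hfS s t h1 h2)
  have hanti : ∀ s s', s ≠ s' → Anti G (S (pos s) (j s)) (S (pos s') (j s')) := by
    intro s s' hss
    refine H.anti _ _ _ _ (hvalid s) (hvalid s') ?_
    by_contra hcon
    push Not at hcon
    exact hss (hinj s s' hcon.1 hcon.2)
  have hend : ∀ s, ∀ t ≤ L s, (∃ i < m, f s t = v i) ∨ (0 < t ∧ t < L s) := by
    intro s t ht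
    by_cases h0 : t = 0
    · exact Or.inl ⟨_, hpos s, h0 ▸ hf0 s⟩
    by_cases hL : t = L s
    · exact Or.inl ⟨_, hmod s, hL ▸ hfL s⟩
    exact Or.inr ⟨by omega, by omega⟩
  have hends : ∀ s s', s ≠ s' → ∀ t ≤ L s, ∀ t' ≤ L s', f s t = f s' t' → t = 0 ∨ t = L s := by
    intro s s' hss t ht t' ht' he
    by_contra hcon
    have h1 : 0 < t ∧ t < L s := by omega
    rcases hend s' t' ht' with ⟨i, hi, h⟩ | h
    · exact hint s t h1.1 h1.2 i hi (he.trans h)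
    · exact (hanti s s' hss _ (hfS s t h1.1 h1.2) _ (hfS s' t' h.1 h.2)).1 he
  have hcentre : ∀ s, ∀ t ≤ L s, ∀ i < m, f s t = v i → t = 0 ∨ t = L s := by
    intro s t ht i hi he
    by_contra hcon
    exact hint s t (by omega) (by omega) i hi he
  have hchord : ∀ x y, G.Adj x y → (∃ s, ∃ t ≤ L s, ∃ t' ≤ L s, x = f s t ∧ y = f s t') →
      ∃ s, ∃ t < L s, s(x, y) = s(f s t, f s (t + 1)) := by
    rintro x y hxy ⟨s, t, ht, t', ht', rfl, rfl⟩
    rcases hfch s t ht t' ht' hxy with rfl | rfl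
    · exact ⟨s, t, ht', rfl⟩
    · exact ⟨s, t', ht, Sym2.eq_swap⟩
  have hvf : ∀ i < m, ∀ s t, 0 < t → t < L s → G.Adj (v i) (f s t) →
      ∃ t' ≤ L s, v i = f s t' := by
    intro i hi s t h1 h2 hadj
    by_cases h3 : i = pos s
    · exact ⟨0, by omega, by rw [h3, hf0]⟩
    by_cases h4 : i = (pos s + 1) % m
    · exact ⟨L s, le_rfl, by rw [h4, hfL]⟩
    exact (H.not_touch _ _ (hvalid s) i hi h3 h4 ⟨_, hfS s t h1 h2, hadj⟩).elim
  have hadjX : ∀ x ∈ X, ∀ y ∈ X, G.Adj x y →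
      ∃ s, ∃ t < L s, s(x, y) = s(f s t, f s (t + 1)) := by
    intro x hx y hy hxy
    refine hchord x y hxy ?_
    rcases hx with ⟨i, hi, rfl⟩ | ⟨s, t, h1, h2, rfl⟩ <;>
      rcases hy with ⟨i', hi', rfl⟩ | ⟨s', t', h1', h2', rfl⟩
    · exfalso
      have hne : i ≠ i' := by rintro rfl; exact G.loopless.irrefl _ hxy
      exact (not_adj_of_lt_edist (by omega) (H.far i hi i' hi' hne)).2 hxy
    · obtain ⟨t, ht, h⟩ := hvf i hi s' t' h1' h2' hxy
      exact ⟨s', t, ht, t', h2'.le, h, rfl⟩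
    · obtain ⟨t', ht', h⟩ := hvf i' hi' s t h1 h2 hxy.symm
      exact ⟨s, t, h2.le, t', ht', rfl, h⟩
    · by_cases hss : s = s'
      · subst hss
        exact ⟨s, t, h2.le, t', h2'.le, rfl, rfl⟩
      · exact ((hanti s s' hss _ (hfS s t h1 h2) _ (hfS s' t' h1' h2')).2 hxy).elim
  -- The reductions by `% m` and `min` keep the values in `X` for indices out of range.
  refine ⟨X, fun i => ⟨v (i % m), hvX i⟩, L, fun s t => ⟨f s (min t (L s)), hfX s _ (min_le_right _ _)⟩,
    hDL, ?_⟩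
  have hval : ∀ s t, t ≤ L s → f s (min t (L s)) = f s t := fun s t ht => by rw [min_eq_left ht]
  constructor
  · exact hpos
  · intro i hi i' hi' he
    have he : v (i % m) = v (i' % m) := congrArg Subtype.val he
    rw [Nat.mod_eq_of_lt hi, Nat.mod_eq_of_lt hi'] at he
    by_contra hne
    exact (not_adj_of_lt_edist (by omega) (H.far i hi i' hi' hne)).1 he
  · intro s
    refine Subtype.ext ?_
    simp only [Nat.zero_min, Nat.mod_eq_of_lt (hpos s), hf0]
  · intro s
    refine Subtype.ext ?_
    simp only [min_self, hfL, Nat.mod_mod]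
  · intro s
    have := hDL s
    omega
  · intro s t ht t' ht' he
    have he := congrArg Subtype.val he
    simp only [hval s t ht, hval s t' ht'] at he
    exact hfinj s t ht t' ht' he
  · intro s t ht
    change G.Adj (f s (min t (L s))) (f s (min (t + 1) (L s)))
    rw [hval s t ht.le, hval s (t + 1) ht]
    exact hfadj s t ht
  · intro s s' hss t ht t' ht' he
    have he := congrArg Subtype.val he
    simp only [hval s t ht, hval s' t' ht'] at he
    exact hends s s' hss t ht t' ht' he
  · intro s t ht i hi he
    have he := congrArg Subtype.val he
    simp only [hval s t ht] at he
    exact hcentre s t ht _ (Nat.mod_lt _ (by omega)) he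
  · intro s s' hss t ht t' ht' he
    have he : s(f s t, f s (t + 1)) = s(f s' t', f s' (t' + 1)) := by
      have := congrArg (Sym2.map Subtype.val) he
      simpa only [Sym2.map_mk, hval s t ht.le, hval s (t + 1) ht, hval s' t' ht'.le,
        hval s' (t' + 1) ht'] using this
    -- Both vertices of a common edge would be ends of the strand `s`, which has length more than
    -- two.
    have hDs := hDL s
    rcases Sym2.eq_iff.1 he with ⟨h, h'⟩ | ⟨h, h'⟩
    · have a1 := hends s s' hss t ht.le t' ht'.le h
      have a2 := hends s s' hss (t + 1) ht (t' + 1) ht' h'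
      omega
    · have a1 := hends s s' hss t ht.le (t' + 1) ht' h
      have a2 := hends s s' hss (t + 1) ht t' ht'.le h'
      omega
  · rintro ⟨x, hx⟩
    rcases hx with ⟨i, hi, rfl⟩ | ⟨s, t, h1, h2, rfl⟩
    · exact Or.inl ⟨i, hi, Subtype.ext (by simp only [Nat.mod_eq_of_lt hi])⟩
    · exact Or.inr ⟨s, t, h2.le, Subtype.ext (hval s t h2.le).symm⟩
  · rintro ⟨x, hx⟩ ⟨y, hy⟩ hxy
    obtain ⟨s, t, ht, h⟩ := hadjX x hx y hy hxy
    refine ⟨s, t, ht, ?_⟩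
    rcases Sym2.eq_iff.1 h with ⟨h1, h2⟩ | ⟨h1, h2⟩
    · refine Sym2.eq_iff.2 (Or.inl ⟨Subtype.ext ?_, Subtype.ext ?_⟩)
      · exact h1.trans (hval s t ht.le).symm
      · exact h2.trans (hval s _ ht).symm
    · refine Sym2.eq_iff.2 (Or.inr ⟨Subtype.ext ?_, Subtype.ext ?_⟩)
      · exact h1.trans (hval s _ ht).symm
      · exact h2.trans (hval s t ht.le).symm

end FromNecklace

/-- Bounded local chromatic number bounds the chromatic number if no induced subgraph is a
subdivision of a graph that is made of strands along a cycle, one link of which is a single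
strand. -/
theorem StrandSystem.exists_bound {W : Type u} [Finite W] {ι : Type v} [Finite ι]
    {J : SimpleGraph W} {m : ℕ} {pos : ι → ℕ} {c : ℕ → W} {ℓ : ι → ℕ} {q : ι → ℕ → W}
    (hJ : StrandSystem J m pos c ℓ q) (hm : 2 ≤ m)
    (hthin : ∀ s s', pos s + 1 = m → pos s' + 1 = m → s = s') (κ τ : ℕ) :
    ∃ b : ℕ, ∀ (V : Type w) [Finite V] (G : SimpleGraph V),
      SubdivisionFree (Graph.ofSimpleGraph J) G → G.cliqueNum ≤ κ →
      localChromaticNumber (2 * Nat.card W + 7) G ≤ τ → G.chromaticNumber ≤ b := by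
  classical
  -- There are enough sets per link to give every strand its own, with `+ 1` making their number
  -- positive. The distance exceeds the length of every strand of `J`, as each is a path on at most
  -- `Nat.card W` vertices.
  obtain ⟨b, hb⟩ := exists_bound_necklace.{w} κ τ m (Nat.card ι + 1) (Nat.card W + 2)
    (2 * Nat.card W + 7) hm (by omega) (by omega) (by omega)
  refine ⟨b, fun V _ G hfree hω hloc => ?_⟩
  rw [SimpleGraph.chromaticNumber_le_iff_colorable]
  refine ColOn.colorable ?_
  by_contra hcol
  have hball : ∀ a, ColOn G {x | G.edist a x ≤ ((2 * Nat.card W + 7 : ℕ) : ℕ∞)} τ := fun a =>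
    ColOn.of_colorable (SimpleGraph.chromaticNumber_le_iff_colorable.1
      ((le_iSup (fun a : V => (G.induce {x | G.edist a x ≤
        ((2 * Nat.card W + 7 : ℕ) : ℕ∞)}).chromaticNumber) a).trans hloc))
  obtain ⟨v, S, hN⟩ := hb V G hω hball hcol
  let e := Finite.equivFin ι
  obtain ⟨X, c', L, Q, hL, hH⟩ := hN.exists_strandSystem (by omega) hm pos
    -- The last link offers only the set numbered 0; by `hthin` it has at most one strand.
    (fun s => if pos s + 1 = m then 0 else e s) hJ.pos_lt
    (fun s => by
      by_cases h : pos s + 1 = m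
      · exact Or.inr ⟨h, by simp [h]⟩
      · have := hJ.pos_lt s
        have := (e s).2
        exact Or.inl ⟨by omega, by simp only [h, if_false]; omega⟩)
    (fun s s' hp hj => by
      by_cases h : pos s + 1 = m
      · exact hthin s s' h (hp ▸ h)
      · have h' : ¬ pos s' + 1 = m := hp ▸ h
        simp only [h, h', if_false] at hj
        exact e.injective (Fin.ext hj))
  refine hfree X (hJ.isSubdivisionOf hH fun s => ?_)
  have hcard : ℓ s + 1 ≤ Nat.card W := by
    have := Nat.card_le_card_of_injective (fun t : Fin (ℓ s + 1) => q s t)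
      (fun t t' h => Fin.ext (hJ.inj s t (by omega) t' (by omega) h))
    simpa using this
  have := hL s
  omega

/-! ### Fattened cycles and banana substitutions as systems of strands. -/

section Strands

variable {W : Type u} {J : SimpleGraph W}

theorem mem_edges_iff_getVert {a b : W} {p : J.Walk a b} {e : Sym2 W} :
    e ∈ p.edges ↔ ∃ t < p.length, e = s(p.getVert t, p.getVert (t + 1)) := by
  induction e with
  | _ x y =>
    rw [← SimpleGraph.Walk.adj_toSubgraph_iff_mem_edges, SimpleGraph.Walk.toSubgraph_adj_iff]
    exact ⟨fun ⟨t, h, ht⟩ => ⟨t, ht, h.symm⟩, fun ⟨t, ht, h⟩ => ⟨t, h.symm, ht⟩⟩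

/-- A path containing the edge between its own ends consists of that edge. Hence two distinct paths
of a banana share no edge: a shared edge would join the two ends, and both paths would be equal to
it. -/
theorem getVert_eq_of_mk_mem_edges {a b : W} {p : J.Walk a b} (hp : p.IsPath)
    (he : s(a, b) ∈ p.edges) (t : ℕ) : p.getVert t = if t = 0 then a else b := by
  obtain ⟨r, hr, h⟩ := mem_edges_iff_getVert.1 he
  have hlen : p.length = 1 := by
    rcases Sym2.eq_iff.1 h with ⟨h1, h2⟩ | ⟨h1, h2⟩
    · have a1 := hp.getVert_injOn (show 0 ≤ p.length by omega) (show r ≤ p.length by omega)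
        (p.getVert_zero.trans h1)
      have a2 := hp.getVert_injOn (show p.length ≤ p.length by omega)
        (show r + 1 ≤ p.length by omega) (p.getVert_length.trans h2)
      omega
    · have a1 := hp.getVert_injOn (show 0 ≤ p.length by omega) (show r + 1 ≤ p.length by omega)
        (p.getVert_zero.trans h1)
      omega
  by_cases ht : t = 0
  · rw [if_pos ht, ht, p.getVert_zero]
  · rw [if_neg ht, p.getVert_of_length_le (by omega)]

/-- Internally disjoint paths between consecutive vertices of a cyclic sequence make up a system
of strands; the numbering may be chosen so that the last link starts at any given place. -/
theorem strandSystem_of_walks {ι : Type v} {m : ℕ} [NeZero m] (i₀ : ZMod m) {x : ZMod m → W}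
    (hx : Function.Injective x) {i : ι → ZMod m} (p : ∀ s, J.Walk (x (i s)) (x (i s + 1)))
    (hp : ∀ s, (p s).IsPath) (hl : ∀ s, 0 < (p s).length)
    (hends : ∀ s s', s ≠ s' → ∀ a ∈ (p s).support, a ∈ (p s').support →
      a = x (i s) ∨ a = x (i s + 1))
    (hc : ∀ s j, x j ∈ (p s).support → x j = x (i s) ∨ x j = x (i s + 1))
    (hedge : ∀ s s', s ≠ s' → ∀ e ∈ (p s).edges, e ∉ (p s').edges)
    (hverts : ∀ a, (∃ j, a = x j) ∨ ∃ s, a ∈ (p s).support)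
    (hadj : ∀ a b, J.Adj a b → ∃ s, s(a, b) ∈ (p s).edges) :
    StrandSystem J m (fun s => (i s - i₀ - 1).val) (fun n => x ((n : ZMod m) + i₀ + 1))
      (fun s => (p s).length) (fun s t => (p s).getVert t) := by
  have hend : ∀ s, ∀ t ≤ (p s).length,
      ((p s).getVert t = x (i s) ∨ (p s).getVert t = x (i s + 1)) → t = 0 ∨ t = (p s).length := by
    rintro s t ht (h | h)
    · exact Or.inl ((hp s).getVert_injOn ht (Nat.zero_le (p s).length)
        (h.trans (p s).getVert_zero.symm))
    · exact Or.inr ((hp s).getVert_injOn ht (le_refl (p s).length)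
        (h.trans (p s).getVert_length.symm))
  constructor
  · exact fun s => ZMod.val_lt _
  · intro a ha b hb h
    have h := hx h
    rw [add_left_inj, add_left_inj, ZMod.natCast_eq_natCast_iff', Nat.mod_eq_of_lt ha,
      Nat.mod_eq_of_lt hb] at h
    exact h
  · intro s
    simp only [SimpleGraph.Walk.getVert_zero, ZMod.natCast_zmod_val]
    congr 1
    ring
  · intro s
    simp only [SimpleGraph.Walk.getVert_length, ZMod.natCast_mod, Nat.cast_add, Nat.cast_one,
      ZMod.natCast_zmod_val]
    congr 1
    ring
  · exact hl
  · exact fun s t ht t' ht' h => (hp s).getVert_injOn ht ht' h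
  · exact fun s t ht => (p s).adj_getVert_succ ht
  · intro s s' hss t ht t' ht' h
    exact hend s t ht (hends s s' hss _ ((p s).getVert_mem_support t)
      (h ▸ (p s').getVert_mem_support t'))
  · intro s t ht j _ h
    have := hc s _ (h ▸ (p s).getVert_mem_support t)
    rw [← h] at this
    exact hend s t ht this
  · intro s s' hss t ht t' ht' h
    exact hedge s s' hss _ (mem_edges_iff_getVert.2 ⟨t, ht, rfl⟩)
      (mem_edges_iff_getVert.2 ⟨t', ht', h⟩)
  · intro a
    rcases hverts a with ⟨j, rfl⟩ | ⟨s, hs⟩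
    · exact Or.inl ⟨(j - i₀ - 1).val, ZMod.val_lt _, by
        rw [ZMod.natCast_zmod_val]; congr 1; ring⟩
    · obtain ⟨t, h, ht⟩ := SimpleGraph.Walk.mem_support_iff_exists_getVert.1 hs
      exact Or.inr ⟨s, t, ht, h.symm⟩
  · intro a b hab
    obtain ⟨s, hs⟩ := hadj a b hab
    obtain ⟨t, ht, h⟩ := mem_edges_iff_getVert.1 hs
    exact ⟨s, t, ht, h⟩

/-- The shift by `i₀ + 1` moves the link that starts at `i₀` to the last position `m - 1`, where the
single strand is required. -/
theorem eq_of_val_sub_sub_one_add_one {m : ℕ} [NeZero m] {i i₀ : ZMod m}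
    (h : (i - i₀ - 1).val + 1 = m) : i = i₀ := by
  have h1 := congrArg (Nat.cast (R := ZMod m)) h
  rw [Nat.cast_add, ZMod.natCast_zmod_val, Nat.cast_one, ZMod.natCast_self, sub_add_cancel,
    sub_eq_zero] at h1
  exact h1

end Strands

/-- A subdivision of a fattened cycle is made of strands. -/
theorem exists_strandSystem_of_fattening {α : Type u} {β : Type v} {γ : Type v'} {W : Type w}
    {m : ℕ} {C : Graph α β} {e₀ : β} {H : Graph α γ} {J : SimpleGraph W}
    (hC : IsCycleMultigraph C m) (he₀ : e₀ ∈ E(C)) (hH : IsFattening C (E(C) \ {e₀}) H)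
    (hJ : IsSubdivisionOf J H) :
    ∃ (pos : E(H) → ℕ) (c : ℕ → W) (ℓ : E(H) → ℕ) (q : E(H) → ℕ → W),
      StrandSystem J m pos c ℓ q ∧ ∀ s s', pos s + 1 = m → pos s' + 1 = m → s = s' := by
  obtain ⟨hm, x, e, hx, he, hV, hE, hlink⟩ := hC
  have : NeZero m := ⟨by omega⟩
  obtain ⟨hVH, π, hπ, -, huniq⟩ := hH
  obtain ⟨φ, B, hB⟩ := hJ
  rw [hE] at he₀
  obtain ⟨i₀, rfl⟩ := he₀
  have hidx : ∀ f : E(H), ∃ i, π f = e i ∧ H.IsLink f (x i) (x (i + 1)) := by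
    rintro ⟨f, hf⟩
    obtain ⟨a, b, hab⟩ := H.exists_isLink_of_mem_edgeSet hf
    have h1 := hπ f a b hab
    have h2 := h1.edge_mem
    rw [hE] at h2
    obtain ⟨i, hi⟩ := h2
    refine ⟨i, hi.symm, ?_⟩
    rw [← hi] at h1
    rcases h1.eq_and_eq_or_eq_and_eq (hlink i) with ⟨rfl, rfl⟩ | ⟨rfl, rfl⟩
    · exact hab
    · exact hab.symm
  choose i hi hHlink using hidx
  choose p hp hl hP using fun f : E(H) => hB.replaces f _ _ (hHlink f)
  have hmem : ∀ (f : E(H)) a, a ∈ (p f).support ↔ a ∈ (B f).verts := fun f a => by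
    rw [hP f, SimpleGraph.Walk.mem_verts_toSubgraph]
  have hinc : ∀ (f : E(H)) y, H.Inc f y → φ y = φ (x (i f)) ∨ φ y = φ (x (i f + 1)) := by
    intro f y hy
    rcases hy.eq_or_eq_of_isLink (hHlink f) with rfl | rfl
    · exact Or.inl rfl
    · exact Or.inr rfl
  have hxV : ∀ j, x j ∈ V(H) := fun j => by rw [hVH, hV]; exact ⟨j, rfl⟩
  refine ⟨_, _, _, _, strandSystem_of_walks i₀ (x := fun j => φ (x j))
    (fun a b h => hx (hB.injOn (hxV a) (hxV b) h)) p hp hl ?_ ?_ ?_ ?_ ?_, ?_⟩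
  · intro f f' hff a ha ha'
    obtain ⟨y, h1, -, rfl⟩ := hB.common_end f f.2 f' f'.2 (fun h => hff (Subtype.ext h)) a
      ((hmem f a).1 ha) ((hmem f' a).1 ha')
    exact hinc f y h1
  · intro f j hj
    exact hinc f _ (hB.inc_of_mem f f.2 _ (hxV j) ((hmem f _).1 hj))
  · intro f f' hff d hd hd'
    have := hB.edge_disjoint f f.2 f' f'.2 (fun h => hff (Subtype.ext h))
    rw [hP f, hP f', SimpleGraph.Walk.edgeSet_toSubgraph, SimpleGraph.Walk.edgeSet_toSubgraph] at this
    exact Set.disjoint_left.1 this hd hd'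
  · intro a
    rcases hB.cover_verts a with ⟨y, hy, rfl⟩ | ⟨f, hf, ha⟩
    · rw [hVH, hV] at hy
      obtain ⟨j, rfl⟩ := hy
      exact Or.inl ⟨j, rfl⟩
    · exact Or.inr ⟨⟨f, hf⟩, (hmem _ _).2 ha⟩
  · intro a b hab
    obtain ⟨f, hf, h⟩ := hB.cover_adj a b hab
    refine ⟨⟨f, hf⟩, ?_⟩
    rw [hP ⟨f, hf⟩, SimpleGraph.Walk.adj_toSubgraph_iff_mem_edges] at h
    exact h
  · intro f f' h h'
    have h1 := hi f
    have h2 := hi f'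
    rw [eq_of_val_sub_sub_one_add_one h] at h1
    rw [eq_of_val_sub_sub_one_add_one h'] at h2
    exact Subtype.ext ((huniq (e i₀) (by rw [hE]; exact ⟨i₀, rfl⟩) (fun h => h.2 rfl)).unique
      ⟨f.2, h1⟩ ⟨f'.2, h2⟩)

/-- A graph obtained from a cycle by substituting bananas is made of strands. -/
theorem exists_strandSystem_of_bananaSubstitution {α : Type u} {β : Type v} {W : Type w} [Finite W]
    {m : ℕ} {C : Graph α β} {e₀ : β} {J : SimpleGraph W}
    (hC : IsCycleMultigraph C m) (he₀ : e₀ ∈ E(C)) (hJ : IsBananaSubstitution C e₀ J) :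
    ∃ (ι : Type w) (_ : Finite ι) (pos : ι → ℕ) (c : ℕ → W) (ℓ : ι → ℕ) (q : ι → ℕ → W),
      StrandSystem J m pos c ℓ q ∧ ∀ s s', pos s + 1 = m → pos s' + 1 = m → s = s' := by
  classical
  obtain ⟨hm, x, e, hx, he, hV, hE, hlink⟩ := hC
  have : NeZero m := ⟨by omega⟩
  obtain ⟨φ, B, hB⟩ := hJ
  rw [hE] at he₀
  obtain ⟨i₀, rfl⟩ := he₀
  have hban : ∀ i, ∃ S : Set (J.Walk (φ (x i)) (φ (x (i + 1)))),
      (∀ p ∈ S, p.IsPath ∧ 0 < p.length) ∧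
      (∀ p ∈ S, ∀ q ∈ S, p ≠ q → ∀ a ∈ p.support, a ∈ q.support →
        a = φ (x i) ∨ a = φ (x (i + 1))) ∧
      (∀ a, a ∈ (B (e i)).verts ↔ ∃ p ∈ S, a ∈ p.support) ∧
      (∀ a b, (B (e i)).Adj a b ↔ ∃ p ∈ S, s(a, b) ∈ p.edges) ∧
      (i = i₀ → ∀ p ∈ S, ∀ q ∈ S, p = q) := by
    intro i
    obtain ⟨h1, h2⟩ := hB.replaces (e i) _ _ (hlink i)
    by_cases hi : i = i₀
    · obtain ⟨hadj, hP⟩ := h1 (by rw [hi])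
      -- The remaining edge is treated as a banana with one path.
      refine ⟨{hadj.toWalk}, ?_, ?_, ?_, ?_, ?_⟩
      · rintro p rfl
        refine ⟨?_, by simp⟩
        rw [SimpleGraph.Walk.isPath_def]
        simp [hadj.ne]
      · rintro p rfl q rfl hpq
        exact (hpq rfl).elim
      · intro a
        rw [hP, ← SimpleGraph.Adj.toSubgraph_toWalk]
        simp
      · intro a b
        rw [hP, ← SimpleGraph.Adj.toSubgraph_toWalk, SimpleGraph.Walk.adj_toSubgraph_iff_mem_edges]
        simp
      · rintro - p rfl q rfl
        rfl
    · obtain ⟨S, -, hS, hdisj, hP⟩ := h2 (fun h => hi (he h))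
      refine ⟨S, hS, hdisj, fun a => ?_, fun a b => ?_, fun h => (hi h).elim⟩
      · rw [hP]
        simp only [SimpleGraph.Subgraph.verts_iSup, Set.mem_iUnion, exists_prop,
          SimpleGraph.Walk.mem_verts_toSubgraph]
      · rw [hP]
        simp only [SimpleGraph.Subgraph.iSup_adj, exists_prop,
          SimpleGraph.Walk.adj_toSubgraph_iff_mem_edges]
  choose S hS hdisj hverts hadj hone using hban
  have hxV : ∀ j, x j ∈ V(C) := fun j => by rw [hV]; exact ⟨j, rfl⟩
  have heE : ∀ i, e i ∈ E(C) := fun i => by rw [hE]; exact ⟨i, rfl⟩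
  have hinc : ∀ i y, C.Inc (e i) y → φ y = φ (x i) ∨ φ y = φ (x (i + 1)) := by
    intro i y hy
    rcases hy.eq_or_eq_of_isLink (hlink i) with rfl | rfl
    · exact Or.inl rfl
    · exact Or.inr rfl
  have hfin : ∀ i, Finite (S i) := by
    intro i
    have := Fintype.ofFinite W
    exact Finite.of_injective (fun p : S i =>
      (⟨p.1, (hS i p.1 p.2).1⟩ : J.Path (φ (x i)) (φ (x (i + 1)))))
      (fun p q h => Subtype.ext (Subtype.mk.inj h))
  refine ⟨Σ i, S i, inferInstance, _, _, _, _, strandSystem_of_walks i₀ (x := fun j => φ (x j))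
    (fun a b h => hx (hB.injOn (hxV a) (hxV b) h)) (i := fun s => s.1) (fun s => s.2.1)
    (fun s => (hS _ _ s.2.2).1) (fun s => (hS _ _ s.2.2).2) ?_ ?_ ?_ ?_ ?_, ?_⟩
  · rintro ⟨i, p, hp⟩ ⟨i', p', hp'⟩ hss a ha ha'
    by_cases hii : i = i'
    · subst hii
      exact hdisj i p hp p' hp' (fun h => hss (by subst h; rfl)) a ha ha'
    · obtain ⟨y, h1, -, rfl⟩ := hB.common_end (e i) (heE i) (e i') (heE i') (fun h => hii (he h)) a
        ((hverts i a).2 ⟨p, hp, ha⟩) ((hverts i' a).2 ⟨p', hp', ha'⟩)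
      exact hinc i y h1
  · rintro ⟨i, p, hp⟩ j hj
    exact hinc i _ (hB.inc_of_mem (e i) (heE i) _ (hxV j) ((hverts i _).2 ⟨p, hp, hj⟩))
  · rintro ⟨i, p, hp⟩ ⟨i', p', hp'⟩ hss d hd hd'
    induction d with
    | _ a b =>
      by_cases hii : i = i'
      · subst hii
        have hpp : p ≠ p' := fun h => hss (by subst h; rfl)
        have h1 := hdisj i p hp p' hp' hpp a (p.fst_mem_support_of_mem_edges hd)
          (p'.fst_mem_support_of_mem_edges hd')
        have h2 := hdisj i p hp p' hp' hpp b (p.snd_mem_support_of_mem_edges hd)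
          (p'.snd_mem_support_of_mem_edges hd')
        have hab : a ≠ b := (p.adj_of_mem_edges hd).ne
        have hs : s(a, b) = s(φ (x i), φ (x (i + 1))) := by
          rcases h1 with rfl | rfl <;> rcases h2 with rfl | rfl
          · exact (hab rfl).elim
          · rfl
          · exact Sym2.eq_swap
          · exact (hab rfl).elim
        refine hpp (SimpleGraph.Walk.ext_getVert fun t => ?_)
        rw [getVert_eq_of_mk_mem_edges (hS i p hp).1 (hs ▸ hd),
          getVert_eq_of_mk_mem_edges (hS i p' hp').1 (hs ▸ hd')]
      · have := hB.edge_disjoint (e i) (heE i) (e i') (heE i') (fun h => hii (he h))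
        exact Set.disjoint_left.1 this (SimpleGraph.Subgraph.mem_edgeSet.2
          ((hadj i a b).2 ⟨p, hp, hd⟩)) (SimpleGraph.Subgraph.mem_edgeSet.2
          ((hadj i' a b).2 ⟨p', hp', hd'⟩))
  · intro a
    rcases hB.cover_verts a with ⟨y, hy, rfl⟩ | ⟨f, hf, ha⟩
    · rw [hV] at hy
      obtain ⟨j, rfl⟩ := hy
      exact Or.inl ⟨j, rfl⟩
    · rw [hE] at hf
      obtain ⟨i, rfl⟩ := hf
      obtain ⟨p, hp, h⟩ := (hverts i a).1 ha
      exact Or.inr ⟨⟨i, p, hp⟩, h⟩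
  · intro a b hab
    obtain ⟨f, hf, h⟩ := hB.cover_adj a b hab
    rw [hE] at hf
    obtain ⟨i, rfl⟩ := hf
    obtain ⟨p, hp, h⟩ := (hadj i a b).1 h
    exact ⟨⟨i, p, hp⟩, h⟩
  · rintro ⟨i, p, hp⟩ ⟨i', p', hp'⟩ h h'
    have h1 : i = i₀ := eq_of_val_sub_sub_one_add_one h
    have h2 : i' = i₀ := eq_of_val_sub_sub_one_add_one h'
    subst h1
    subst h2
    obtain rfl := hone _ rfl p hp p' hp'
    rfl

theorem theorem1p13 :
    (∀ (α : Type u) (β : Type v) (γ : Type v') (m : ℕ) (C : Graph α β) (e₀ : β) (H : Graph α γ),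
      IsCycleMultigraph C m → e₀ ∈ E(C) → E(H).Finite → IsFattening C (E(C) \ {e₀}) H →
      Widespread.{w} H) ∧
    (∀ (α : Type u) (β : Type v) (m : ℕ) (C : Graph α β) (e₀ : β) (W : Type w) [Finite W]
      (J : SimpleGraph W),
      IsCycleMultigraph C m → e₀ ∈ E(C) → IsBananaSubstitution C e₀ J →
      ∀ κ τ : ℕ, ∃ c : ℕ, ∀ (V : Type w) [Finite V] (G : SimpleGraph V),
        SubdivisionFree (Graph.ofSimpleGraph J) G → G.cliqueNum ≤ κ →
        localChromaticNumber (2 * Nat.card W + 7) G ≤ τ → G.chromaticNumber ≤ c) := by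
  constructor
  · intro α β γ m C e₀ H hC he₀ hfin hH W _ J hJ κ
    obtain ⟨pos, c, ℓ, q, hsys, hthin⟩ := exists_strandSystem_of_fattening hC he₀ hH hJ
    have : Finite E(H) := hfin
    -- This radius depends on `J` alone, not on `κ`; only the final bound on the chromatic number
    -- depends on `κ` and `τ`.
    refine ⟨2 * Nat.card W + 7, fun 𝒞 _ hfree ⟨τ, hτ⟩ => ?_⟩
    obtain ⟨b, hb⟩ := hsys.exists_bound hC.1 hthin κ τ
    exact ⟨b, fun V _ G hG => hb V G (hfree V G hG).1 (hfree V G hG).2 (hτ V G hG)⟩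
  · intro α β m C e₀ W _ J hC he₀ hJ κ τ
    obtain ⟨ι, _, pos, c, ℓ, q, hsys, hthin⟩ :=
      exists_strandSystem_of_bananaSubstitution hC he₀ hJ
    exact hsys.exists_bound hC.1 hthin κ τ
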